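/- **Setting.** A microgrid is a connected graph on $n\ge 1$ load buses and $m\ge 1$ inverter buses whose branches $\{i,j\}$ are purely inductive, with admittance $\mathrm{j}b_{ij}$, $b_{ij}=b_{ji}<0$ (and $b_{ij}=0$ if there is no branch). Its susceptance matrix is $B_{ij}=-b_{ij}$ for $i\neq j$, $B_{ii}=\sum_{j\ne i}b_{ij}$, with blocks $B_{LL},B_{LI},B_{IL},B_{II}$. Let $\tau_i>0$, $K_i<0$, $E_i^*>0$ be the inverter time constants, controller gains and voltage set points, $\tau_I=\mathrm{diag}(\tau_i)$, $K_I=\mathrm{diag}(K_i)$, $E_I^*=(E_i^*)$, and write $[x]$ for the diagonal matrix of a vector $x$. For a load model $Q_L(\cdot)$ the closed-loop system under quadratic droop control is the differential-algebraic system $$\begin{pmatrix}0\\ \tau_I\dot E_I\end{pmatrix}=\begin{pmatrix}Q_L(E_L)\\ [E_I]K_I(E_I-E_I^*)\end{pmatrix}+[E]BE,\qquad E=(E_L,E_I).$$ Put $B_{\rm red}=B_{LL}-B_{LI}(B_{II}+K_I)^{-1}B_{IL}$ and $E_L^*=-B_{\rm red}^{-1}B_{LI}(B_{II}+K_I)^{-1}K_IE_I^*$.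 The reduced power flow equation is $$0=Q_L(E_L)+[E_L]B_{\rm red}(E_L-E_L^*),$$ and a positive solution $E_L$ of it has the corresponding equilibrium $(E_L,E_I)$ with $E_I=(B_{II}+K_I)^{-1}(K_IE_I^*-B_{IL}E_L)$. **Theorem (Stability with "ZIP" loads).** Let $b_{\rm shunt},I_{\rm shunt}\in\mathbb{R}^n$ be such that (i) $-(B_{\rm red}+[b_{\rm shunt}])$ is an $M$-matrix (off-diagonal entries $\le 0$, all eigenvalues with positive real part) and (ii) $I_{\rm shunt}>B_{\rm red}E_L^*$ componentwise. Let $$E_L^{\rm ZI}=(B_{\rm red}+[b_{\rm shunt}])^{-1}(B_{\rm red}E_L^*-I_{\rm shunt}),\qquad Q_{\rm sc}=[E_L^{\rm ZI}](B_{\rm red}+[b_{\rm shunt}])[E_L^{\rm ZI}].$$ Then $E_L^{\rm ZI}$ is a positive solution of the reduced power flow equation for $Q_L(E_L)=[E_L][b_{\rm shunt}]E_L+[E_L]I_{\rm shunt}$, the matrix $Q_{\rm sc}$ is invertible, and there are constants $\delta>0$, $r>0$, $C$ (independent of $Q_L$) such that for every $Q_L\in\mathbb{R}^n$ with $\|Q_L\|<\delta$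 the following holds. The reduced power flow equation with ZIP loads $Q_L^{\rm ZIP}(E_L)=[E_L][b_{\rm shunt}]E_L+[E_L]I_{\rm shunt}+Q_L$ has a unique high-voltage solution $E_L^{\rm ZIP}\in\mathbb{R}^n_{>0}$, that is, a positive solution that is componentwise at least as large as every positive solution; it is also the only positive solution at distance less than $r$ from $E_L^{\rm ZI}$. Moreover $$E_L^{\rm ZIP}=[E_L^{\rm ZI}]\left(\mathbf 1_n-Q_{\rm sc}^{-1}Q_L+\epsilon\right)\quad\text{for some }\epsilon\in\mathbb{R}^n\text{ with }\|\epsilon\|\le C\,\|Q_{\rm sc}^{-1}Q_L\|^2,$$ and the corresponding equilibrium $(E_L^{\rm ZIP},E_I^{\rm ZIP})$ of the closed-loop system is locally exponentially stable. -/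

import Mathlib

open scoped Matrix

noncomputable section

/-- A square real matrix is an M-matrix if its off-diagonal entries are nonpositive and all its
(complex) eigenvalues have positive real part. -/
def IsMMatrix {n : ℕ} (A : Matrix (Fin n) (Fin n) ℝ) : Prop :=
  (∀ i j, i ≠ j → A i j ≤ 0) ∧
    ∀ μ ∈ spectrum ℂ (A.map (fun x : ℝ => (x : ℂ))), 0 < μ.re

/-- A purely inductive microgrid with load buses `Sum.inl i`, `i : Fin n`, and inverter buses
`Sum.inr i`, `i : Fin m`, together with the parameters of its inverters and of their quadratic
droop controllers. -/
structure Microgrid (n m : ℕ) where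
  /-- the graph of buses and branches -/
  graph : SimpleGraph (Fin n ⊕ Fin m)
  connected : graph.Connected
  /-- branch susceptances: the branch `{i, j}` has admittance `√(-1) * b i j` -/
  b : Fin n ⊕ Fin m → Fin n ⊕ Fin m → ℝ
  b_symm : ∀ i j, b i j = b j i
  /-- branches are inductive -/
  b_neg : ∀ i j, graph.Adj i j → b i j < 0
  b_zero : ∀ i j, ¬ graph.Adj i j → b i j = 0
  /-- inverter time constants -/
  tau : Fin m → ℝ
  tau_pos : ∀ i, 0 < tau i
  /-- controller gains -/
  K : Fin m → ℝ
  K_neg : ∀ i, K i < 0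
  /-- inverter voltage set points -/
  Eset : Fin m → ℝ
  Eset_pos : ∀ i, 0 < Eset i

namespace Microgrid

variable {n m : ℕ} (M : Microgrid n m)

/-- The susceptance matrix `B`: the imaginary part of the bus admittance matrix. -/
def B : Matrix (Fin n ⊕ Fin m) (Fin n ⊕ Fin m) ℝ :=
  Matrix.of fun i j => if i = j then ∑ k ∈ Finset.univ.erase i, M.b i k else - M.b i j

/-- The block `B_LL`. -/
def BLL : Matrix (Fin n) (Fin n) ℝ := M.B.toBlocks₁₁

/-- The block `B_LI`. -/
def BLI : Matrix (Fin n) (Fin m) ℝ := M.B.toBlocks₁₂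

/-- The block `B_IL`. -/
def BIL : Matrix (Fin m) (Fin n) ℝ := M.B.toBlocks₂₁

/-- The block `B_II`. -/
def BII : Matrix (Fin m) (Fin m) ℝ := M.B.toBlocks₂₂

/-- The diagonal gain matrix `K_I`. -/
def KI : Matrix (Fin m) (Fin m) ℝ := Matrix.diagonal M.K

/-- The reduced susceptance matrix `B_LL - B_LI (B_II + K_I)⁻¹ B_IL`. -/
def Bred : Matrix (Fin n) (Fin n) ℝ := M.BLL - M.BLI * (M.BII + M.KI)⁻¹ * M.BIL

/-- The averaging matrix `W₁ = - B_red⁻¹ B_LI (B_II + K_I)⁻¹ K_I`. -/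
def W₁ : Matrix (Fin n) (Fin m) ℝ := - (M.Bred⁻¹ * M.BLI * (M.BII + M.KI)⁻¹ * M.KI)

/-- The averaging matrix `W₂ = (B_II + K_I)⁻¹ (-B_IL  K_I)`. -/
def W₂ : Matrix (Fin m) (Fin n ⊕ Fin m) ℝ :=
  (M.BII + M.KI)⁻¹ * Matrix.fromCols (- M.BIL) M.KI

/-- The open-circuit load voltages `E_L^* = W₁ E_I^*`. -/
def Eopen : Fin n → ℝ := M.W₁ *ᵥ M.Eset

/-- The right-hand side of the closed-loop system with static load model `Q` :
`(Q_L(E_L), [E_I] K_I (E_I - E_I^*)) + [E] B E`. -/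
def closedLoop (Q : Fin n → ℝ → ℝ) (E : Fin n ⊕ Fin m → ℝ) : Fin n ⊕ Fin m → ℝ :=
  Sum.elim (fun i => Q i (E (Sum.inl i)))
      (fun i => E (Sum.inr i) * (M.K i * (E (Sum.inr i) - M.Eset i)))
    + fun i => E i * (M.B *ᵥ E) i

/-- A (positive) equilibrium of the closed-loop system. -/
def IsEquilibrium (Q : Fin n → ℝ → ℝ) (E : Fin n ⊕ Fin m → ℝ) : Prop :=
  (∀ i, 0 < E i) ∧ M.closedLoop Q E = 0

/-- `E` solves the differential-algebraic closed-loop system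
`(0, τ_I dE_I/dt) = closedLoop Q E` on the time interval `J`. -/
def IsTrajectory (Q : Fin n → ℝ → ℝ) (J : Set ℝ) (E : ℝ → Fin n ⊕ Fin m → ℝ) : Prop :=
  ContinuousOn E J ∧ ∀ t ∈ J,
    (∀ i : Fin n, M.closedLoop Q (E t) (Sum.inl i) = 0) ∧
    ∀ i : Fin m, HasDerivWithinAt (fun s => E s (Sum.inr i))
      (M.closedLoop Q (E t) (Sum.inr i) / M.tau i) J t

/-- Local exponential stability of an equilibrium of the differential-algebraic closed-loop
system: from each initial value close to `Eeq` that satisfies the algebraic equations there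
starts a solution for all times `t ≥ 0`, and every solution, on whatever interval `[0, T)`, that
starts close to `Eeq` obeys an exponential decay estimate with uniform constants. -/
def IsLocallyExpStable (Q : Fin n → ℝ → ℝ) (Eeq : Fin n ⊕ Fin m → ℝ) : Prop :=
  M.IsEquilibrium Q Eeq ∧
  ∃ r > 0, ∃ c > 0, ∃ lam > 0,
    (∀ E₀ : Fin n ⊕ Fin m → ℝ, ‖E₀ - Eeq‖ < r →
      (∀ i : Fin n, M.closedLoop Q E₀ (Sum.inl i) = 0) →
      ∃ E : ℝ → Fin n ⊕ Fin m → ℝ, M.IsTrajectory Q (Set.Ici 0) E ∧ E 0 = E₀) ∧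
    ∀ (T : ℝ) (E : ℝ → Fin n ⊕ Fin m → ℝ),
      M.IsTrajectory Q (Set.Ico 0 T) E → ‖E 0 - Eeq‖ < r →
      ∀ t ∈ Set.Ico 0 T, ‖E t - Eeq‖ ≤ c * Real.exp (-(lam * t)) * ‖E 0 - Eeq‖

/-- `EL` is a positive solution of the reduced power flow equation
`0 = Q_L(E_L) + [E_L] B_red (E_L - E_L^*)`. -/
def IsPositiveReducedSolution (Q : Fin n → ℝ → ℝ) (EL : Fin n → ℝ) : Prop :=
  (∀ i, 0 < EL i) ∧ ∀ i, 0 = Q i (EL i) + EL i * (M.Bred *ᵥ (EL - M.Eopen)) i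

/-- `EL` is the highest-voltage positive solution of the reduced power flow equation: it is
componentwise at least as large as every positive solution. -/
def IsHighVoltageSolution (Q : Fin n → ℝ → ℝ) (EL : Fin n → ℝ) : Prop :=
  IsGreatest {x : Fin n → ℝ | M.IsPositiveReducedSolution Q x} EL

/-- The inverter voltages `E_I = W₂ (E_L, E_I^*)` that belong to load voltages `E_L`. -/
def inverterVoltages (EL : Fin n → ℝ) : Fin m → ℝ := M.W₂ *ᵥ Sum.elim EL M.Eset

/-- The ZI solution `E_L^ZI = (B_red + [b_shunt])⁻¹ (B_red E_L^* - I_shunt)`. -/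
def EZI (bsh Ish : Fin n → ℝ) : Fin n → ℝ :=
  (M.Bred + Matrix.diagonal bsh)⁻¹ *ᵥ (M.Bred *ᵥ M.Eopen - Ish)

/-- The short-circuit capacity matrix `[E_L^ZI] (B_red + [b_shunt]) [E_L^ZI]`. -/
def Qsc (bsh Ish : Fin n → ℝ) : Matrix (Fin n) (Fin n) ℝ :=
  Matrix.diagonal (M.EZI bsh Ish) * (M.Bred + Matrix.diagonal bsh) *
    Matrix.diagonal (M.EZI bsh Ish)

end Microgrid

/-- The ZIP load model `Q_i(E_i) = b_i E_i² + I_i E_i + Q_i`. -/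
def zipLoad {n : ℕ} (bsh Ish QL : Fin n → ℝ) (i : Fin n) (x : ℝ) : ℝ :=
  bsh i * x ^ 2 + Ish i * x + QL i

end

/-! Write `A` for -(B_red + [b_shunt]), `e` for E_L^ZI and c = `A *ᵥ e` = I_shunt - B_red E_L^* > 0.
Symmetry and the M-matrix hypothesis make `A` positive definite, hence inverse positive, so e > 0.
The reduced ZIP equations become x_i ((A x)_i - c_i) = Q_i, that is x = e + A⁻¹(Q / x). For small Q
this map contracts a ball around `e` (`exists_eq_add_mulVec_div`), and inserting the fixed point
into itself gives the expansion. That it dominates every positive solution, and is the only one near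
`e`, follows from a discrete maximum principle (`le_of_mul_mulVec_sub_eq`).

For stability, let S be the full susceptance matrix with b_shunt and K_I added to its diagonal. Its
negative is positive definite, because its inverter block and the Schur complement `A` are. For the
difference v of two states obeying the load equations, the load rows contribute only O(Q)|v|² to
v·Sv, so -v_I·(Sv)_I ≥ (3/4) k |v|² (`mul_dotProduct_sub_le`). This bounds the load deviations by
the inverter deviations and makes ∑ τ_i v_i² / F_i a strict Lyapunov function near the equilibrium F
(`sum_lyapunov_deriv_le`, `exists_exp_decay`). Solutions exist for all times because the load
equations can be solved for E_L near F. Clamping E_I turns the system into a bounded Lipschitz ODE,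
and the decay estimate keeps the solution where the clamp is inactive. -/

open scoped Matrix

/-! ### Finite families of reals and the maximum norm. -/

section FiniteProducts

theorem exists_pos_forall_le {ι : Type*} [Finite ι] (f : ι → ℝ) : ∃ c > 0, ∀ i, f i ≤ c := by
  obtain ⟨c, hc⟩ := (Set.finite_range f).bddAbove
  exact ⟨max c 1, by positivity, fun i => (hc ⟨i, rfl⟩).trans (le_max_left _ _)⟩

theorem exists_pos_forall_ge {ι : Type*} [Finite ι] {f : ι → ℝ} (hf : ∀ i, 0 < f i) :
    ∃ c > 0, ∀ i, c ≤ f i := by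
  obtain ⟨c, hc, h⟩ := exists_pos_forall_le fun i => (f i)⁻¹
  exact ⟨c⁻¹, inv_pos.2 hc, fun i => (inv_le_comm₀ (hf i) hc).1 (h i)⟩

theorem Pi.norm_comp_le_norm {ι κ : Type*} [Fintype ι] [Fintype κ] (v : ι → ℝ) (f : κ → ι) :
    ‖v ∘ f‖ ≤ ‖v‖ :=
  (pi_norm_le_iff_of_nonneg (norm_nonneg _)).2 fun i => norm_le_pi_norm v (f i)

/-- The retraction of a space of vectors with the maximum norm onto a closed ball. -/
def Pi.clamp {ι : Type*} (c : ι → ℝ) (σ : ℝ) (y : ι → ℝ) : ι → ℝ :=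
  fun i => max (c i - σ) (min (c i + σ) (y i))

theorem Pi.norm_clamp_sub_clamp_le {ι : Type*} [Fintype ι] (c : ι → ℝ) (σ : ℝ) (y z : ι → ℝ) :
    ‖Pi.clamp c σ y - Pi.clamp c σ z‖ ≤ ‖y - z‖ := by
  refine (pi_norm_le_iff_of_nonneg (norm_nonneg _)).2 fun i => ?_
  refine le_trans ?_ (norm_le_pi_norm (y - z) i)
  simp only [Pi.clamp, Pi.sub_apply, Real.norm_eq_abs]
  refine (abs_max_sub_max_le_max _ _ _ _).trans ?_
  rw [sub_self, abs_zero]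
  refine max_le (abs_nonneg _) ((abs_min_sub_min_le_max _ _ _ _).trans ?_)
  simp

theorem Pi.norm_clamp_sub_le {ι : Type*} [Fintype ι] (c : ι → ℝ) {σ : ℝ} (hσ : 0 ≤ σ) (y : ι → ℝ) :
    ‖Pi.clamp c σ y - c‖ ≤ σ := by
  refine (pi_norm_le_iff_of_nonneg hσ).2 fun i => ?_
  rw [Real.norm_eq_abs, Pi.sub_apply, abs_le, Pi.clamp]
  constructor
  · linarith [le_max_left (c i - σ) (min (c i + σ) (y i))]
  · have : max (c i - σ) (min (c i + σ) (y i)) ≤ c i + σ :=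
      max_le (by linarith) (min_le_left _ _)
    linarith

theorem Pi.clamp_eq_self {ι : Type*} [Fintype ι] {c y : ι → ℝ} {σ : ℝ} (h : ‖y - c‖ ≤ σ) :
    Pi.clamp c σ y = y := by
  funext i
  have h1 := abs_le.1 ((norm_le_pi_norm (y - c) i).trans h)
  rw [Pi.sub_apply] at h1
  rw [Pi.clamp, min_eq_right (by linarith), max_eq_right (by linarith)]

theorem Pi.norm_sumElim_sub_le {ι κ : Type*} [Fintype ι] [Fintype κ]
    {x : ι → ℝ} {y : κ → ℝ} {F : ι ⊕ κ → ℝ} {ρ : ℝ}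
    (hx : ‖x - F ∘ Sum.inl‖ ≤ ρ) (hy : ‖y - F ∘ Sum.inr‖ ≤ ρ) : ‖Sum.elim x y - F‖ ≤ ρ := by
  refine (pi_norm_le_iff_of_nonneg ((norm_nonneg _).trans hx)).2 ?_
  rintro (i | i)
  · exact (norm_le_pi_norm (x - F ∘ Sum.inl) i).trans hx
  · exact (norm_le_pi_norm (y - F ∘ Sum.inr) i).trans hy

end FiniteProducts

/-! ### Positive definite matrices: coercivity, inverse positivity, Schur complements. -/

namespace Matrix

variable {ι κ : Type*} [Fintype ι] [Fintype κ]

theorem exists_norm_mulVec_le (P : Matrix κ ι ℝ) : ∃ p > 0, ∀ v, ‖P *ᵥ v‖ ≤ p * ‖v‖ := by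
  obtain ⟨p, hp, h⟩ := (LinearMap.toContinuousLinearMap P.mulVecLin).bound
  exact ⟨p, hp, h⟩

theorem dotProduct_self_le_card_mul_norm_sq (v : ι → ℝ) :
    v ⬝ᵥ v ≤ Fintype.card ι * ‖v‖ ^ 2 := by
  have h : ∀ i ∈ Finset.univ, v i * v i ≤ ‖v‖ ^ 2 := fun i _ => by
    rw [← sq, ← sq_abs]
    exact pow_le_pow_left₀ (abs_nonneg _) (norm_le_pi_norm v i) 2
  simpa [dotProduct, nsmul_eq_mul] using Finset.sum_le_card_nsmul _ _ _ h

theorem norm_sq_le_dotProduct_self (v : ι → ℝ) : ‖v‖ ^ 2 ≤ v ⬝ᵥ v := by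
  have h0 : 0 ≤ v ⬝ᵥ v := Finset.sum_nonneg fun i _ => mul_self_nonneg _
  have : ‖v‖ ≤ √(v ⬝ᵥ v) := by
    refine (pi_norm_le_iff_of_nonneg (Real.sqrt_nonneg _)).2 fun i => ?_
    rw [Real.norm_eq_abs, ← Real.sqrt_sq_eq_abs, sq]
    exact Real.sqrt_le_sqrt
      (Finset.single_le_sum (f := fun j => v j * v j) (fun j _ => mul_self_nonneg _)
        (Finset.mem_univ i))
  calc ‖v‖ ^ 2 ≤ √(v ⬝ᵥ v) ^ 2 := pow_le_pow_left₀ (norm_nonneg _) this 2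
    _ = _ := Real.sq_sqrt h0

/-- The form attains a positive minimum on the compact unit sphere; homogeneity does the rest. -/
theorem PosDef.exists_mul_dotProduct_le {A : Matrix ι ι ℝ} (hA : A.PosDef) :
    ∃ k > 0, ∀ v, k * (v ⬝ᵥ v) ≤ v ⬝ᵥ A *ᵥ v := by
  classical
  have hpos : ∀ v : ι → ℝ, v ≠ 0 → 0 < v ⬝ᵥ A *ᵥ v := fun v hv => by
    simpa using hA.dotProduct_mulVec_pos hv
  have hcont : Continuous fun v : ι → ℝ => v ⬝ᵥ A *ᵥ v := by
    unfold dotProduct mulVec dotProduct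
    fun_prop
  have hself : ∀ v : ι → ℝ, v ⬝ᵥ v ≤ Fintype.card ι * ‖v‖ ^ 2 := dotProduct_self_le_card_mul_norm_sq
  have hK : IsCompact (Metric.sphere (0 : ι → ℝ) 1) := isCompact_sphere _ _
  have key : ∃ k > 0, ∀ v ∈ Metric.sphere (0 : ι → ℝ) 1, k ≤ v ⬝ᵥ A *ᵥ v := by
    rcases (Metric.sphere (0 : ι → ℝ) 1).eq_empty_or_nonempty with h | h
    · exact ⟨1, one_pos, by simp [h]⟩
    · obtain ⟨w, hw, hmin⟩ := hK.exists_isMinOn h hcont.continuousOn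
      refine ⟨_, hpos w ?_, fun v hv => hmin hv⟩
      rintro rfl
      simp at hw
  obtain ⟨k, hk, hmin⟩ := key
  -- The cardinality converts the maximum norm to the Euclidean one; the extra 1 keeps the constant
  -- positive when `ι` is empty.
  refine ⟨k / (Fintype.card ι + 1), by positivity, fun v => ?_⟩
  rcases eq_or_ne v 0 with rfl | hv
  · simp
  have hn : 0 < ‖v‖ := norm_pos_iff.2 hv
  have h1 : k * ‖v‖ ^ 2 ≤ v ⬝ᵥ A *ᵥ v := by
    have := hmin (‖v‖⁻¹ • v) (by simp [norm_smul, hn.ne'])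
    rw [mulVec_smul, smul_dotProduct, dotProduct_smul, smul_eq_mul, smul_eq_mul] at this
    calc k * ‖v‖ ^ 2 ≤ (‖v‖⁻¹ * (‖v‖⁻¹ * (v ⬝ᵥ A *ᵥ v))) * ‖v‖ ^ 2 := by gcongr
      _ = _ := by field_simp
  calc k / (Fintype.card ι + 1) * (v ⬝ᵥ v)
      ≤ k / (Fintype.card ι + 1) * ((Fintype.card ι + 1) * ‖v‖ ^ 2) := by
        gcongr
        nlinarith [hself v, sq_nonneg ‖v‖]
    _ = k * ‖v‖ ^ 2 := by field_simp
    _ ≤ _ := h1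

/-- Inverse positivity of positive definite matrices with nonpositive off-diagonal entries. -/
theorem PosDef.pos_of_mulVec_pos {A : Matrix ι ι ℝ} (hA : A.PosDef)
    (hoff : ∀ i j, i ≠ j → A i j ≤ 0) {x : ι → ℝ} (hx : ∀ i, 0 < (A *ᵥ x) i) (i : ι) :
    0 < x i := by
  classical
  have hnonneg : ∀ i, 0 ≤ x i := by
    -- Testing with the negative part `q` of `x`: the signs of the off-diagonal entries give 0 ≤
    -- q·Ax ≤ -q·Aq, hence q = 0.
    set q : ι → ℝ := fun i => max (-x i) 0 with hq
    have hq0 : ∀ i, 0 ≤ q i := fun i => le_max_right _ _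
    have hle : q ⬝ᵥ A *ᵥ x ≤ -(q ⬝ᵥ A *ᵥ q) := by
      simp only [dotProduct, mulVec, Finset.mul_sum, ← Finset.sum_neg_distrib]
      refine Finset.sum_le_sum fun i _ => Finset.sum_le_sum fun j _ => ?_
      rcases le_total 0 (x i) with hi | hi
      · simp [hq, hi]
      rcases eq_or_ne i j with rfl | hij
      · simp [hq, hi]
      have hqx : 0 ≤ x j + q j := by
        have := le_max_left (-x j) 0
        simp only [hq]
        linarith
      nlinarith [mul_nonneg (hq0 i) (mul_nonneg (neg_nonneg.2 (hoff i j hij)) hqx)]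
    have h0 : 0 ≤ q ⬝ᵥ A *ᵥ x :=
      Finset.sum_nonneg fun i _ => mul_nonneg (hq0 i) (hx i).le
    have hqz : q = 0 := by
      by_contra hne
      have : 0 < q ⬝ᵥ A *ᵥ q := by simpa using hA.dotProduct_mulVec_pos hne
      linarith
    intro i
    have := congrFun hqz i
    simp only [hq, Pi.zero_apply, max_eq_right_iff] at this
    linarith
  refine lt_of_le_of_ne (hnonneg i) fun hi => ?_
  have : (A *ᵥ x) i ≤ 0 := by
    refine Finset.sum_nonpos fun j _ => ?_
    rcases eq_or_ne i j with rfl | hij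
    · simp [← hi]
    · exact mul_nonpos_of_nonpos_of_nonneg (hoff i j hij) (hnonneg j)
  linarith [hx i]

variable [DecidableEq ι]

theorem IsHermitian.posDef_of_spectrum_re_pos {A : Matrix ι ι ℝ} (hA : A.IsHermitian)
    (h : ∀ μ ∈ spectrum ℂ (A.map (fun x : ℝ => (x : ℂ))), 0 < μ.re) : A.PosDef := by
  rw [hA.posDef_iff_eigenvalues_pos]
  intro i
  have hdet : (algebraMap ℝ (Matrix ι ι ℝ) (hA.eigenvalues i) - A).det = 0 := by
    have := hA.eigenvalues_mem_spectrum_real i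
    rw [spectrum.mem_iff, isUnit_iff_isUnit_det, isUnit_iff_ne_zero, not_not] at this
    exact this
  have := h (hA.eigenvalues i) (by
    rw [spectrum.mem_iff, isUnit_iff_isUnit_det, isUnit_iff_ne_zero, not_not]
    have e : algebraMap ℂ (Matrix ι ι ℂ) (hA.eigenvalues i) - A.map (fun x : ℝ => (x : ℂ)) =
        (algebraMap ℝ (Matrix ι ι ℝ) (hA.eigenvalues i) - A).map Complex.ofRealHom := by
      ext a b
      by_cases hab : a = b <;> simp [algebraMap_matrix_apply, hab]
    rw [e, ← RingHom.mapMatrix_apply, ← RingHom.map_det, hdet, map_zero])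
  simpa using this

/-- The Schur criterion yields semidefiniteness; the determinant, a product of two positive ones,
excludes a kernel. -/
theorem PosDef.fromBlocks_of_schur [DecidableEq κ] {A : Matrix κ κ ℝ} {B : Matrix κ ι ℝ}
    {D : Matrix ι ι ℝ} (hD : D.PosDef) (hS : (A - B * D⁻¹ * Bᵀ).PosDef) :
    (fromBlocks A B Bᵀ D).PosDef := by
  let _ := hD.isUnit.invertible
  have hB : Bᴴ = Bᵀ := by ext; simp
  have hps : (fromBlocks A B Bᵀ D).PosSemidef := by
    rw [← hB]
    exact (PosDef.fromBlocks₂₂ A B hD).2 (by rw [hB]; exact hS.posSemidef)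
  refine hps.posDef_iff_isUnit.2 ?_
  rw [isUnit_iff_isUnit_det, det_fromBlocks₂₂, invOf_eq_nonsing_inv]
  exact (hD.det_pos.ne'.isUnit).mul hS.det_pos.ne'.isUnit

end Matrix

/-! ### Small solutions of the power flow equation: existence and comparison. -/

section PowerFlow

open Metric

variable {ι : Type*} [Fintype ι]

theorem Pi.norm_div_le_of_le {Q x : ι → ℝ} {a : ℝ} (ha : 0 < a) (hx : ∀ i, a ≤ x i) :
    ‖Q / x‖ ≤ ‖Q‖ / a := by
  refine (pi_norm_le_iff_of_nonneg (by positivity)).2 fun i => ?_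
  rw [Pi.div_apply, norm_div]
  have : a ≤ ‖x i‖ := (hx i).trans (le_abs_self _)
  gcongr
  exact norm_le_pi_norm Q i

theorem Pi.norm_div_sub_div_le {Q x y : ι → ℝ} {a : ℝ} (ha : 0 < a) (hx : ∀ i, a ≤ x i)
    (hy : ∀ i, a ≤ y i) : ‖Q / x - Q / y‖ ≤ ‖Q‖ / a ^ 2 * ‖x - y‖ := by
  refine (pi_norm_le_iff_of_nonneg (by positivity)).2 fun i => ?_
  have hxi := ha.trans_le (hx i)
  have hyi := ha.trans_le (hy i)
  have : (Q / x - Q / y) i = Q i / (x i * y i) * (y - x) i := by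
    simp only [Pi.sub_apply, Pi.div_apply]
    field_simp
  rw [this, norm_mul, norm_div, norm_sub_rev x y]
  have h2 : a ^ 2 ≤ ‖x i * y i‖ := by
    rw [sq, Real.norm_of_nonneg (by positivity)]
    exact mul_le_mul (hx i) (hy i) ha.le hxi.le
  gcongr
  · exact norm_le_pi_norm Q i
  · exact norm_le_pi_norm (y - x) i

/-- On the ball all components are at least `a`, where Q / x has Lipschitz constant ‖Q‖ / a², so the
map contracts with factor 1/2. The free offset `u` lets the lemma serve both the reduced equation
and the load equations at prescribed inverter voltages. -/
theorem exists_eq_add_mulVec_div {P : Matrix ι ι ℝ} {p a ρ : ℝ} (hp0 : 0 ≤ p)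
    (hp : ∀ v, ‖P *ᵥ v‖ ≤ p * ‖v‖) (ha : 0 < a) (hρ : 0 ≤ ρ) {x₀ u Q : ι → ℝ}
    (hx₀ : ∀ i, a + ρ ≤ x₀ i) (hQ : p * ‖Q‖ ≤ a ^ 2 / 2)
    (h₀ : ‖u + P *ᵥ (Q / x₀) - x₀‖ ≤ ρ / 2) :
    ∃ x ∈ closedBall x₀ ρ, x = u + P *ᵥ (Q / x) := by
  set F : (ι → ℝ) → ι → ℝ := fun x => u + P *ᵥ (Q / x) with hF
  have hge : ∀ x ∈ closedBall x₀ ρ, ∀ i, a ≤ x i := fun x hx i => by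
    have h1 := (norm_le_pi_norm (x - x₀) i).trans (mem_closedBall_iff_norm.1 hx)
    have h2 := neg_abs_le ((x - x₀) i)
    rw [Real.norm_eq_abs] at h1
    have h3 := hx₀ i
    simp only [Pi.sub_apply] at h1 h2
    linarith
  have hlip : ∀ x ∈ closedBall x₀ ρ, ∀ y ∈ closedBall x₀ ρ, ‖F x - F y‖ ≤ 1 / 2 * ‖x - y‖ := by
    intro x hx y hy
    have e : F x - F y = P *ᵥ (Q / x - Q / y) := by
      simp only [hF, Matrix.mulVec_sub]
      abel
    rw [e]
    calc ‖P *ᵥ (Q / x - Q / y)‖ ≤ p * (‖Q‖ / a ^ 2 * ‖x - y‖) :=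
          (hp _).trans (by gcongr; exact Pi.norm_div_sub_div_le ha (hge x hx) (hge y hy))
      _ = p * ‖Q‖ / a ^ 2 * ‖x - y‖ := by ring
      _ ≤ 1 / 2 * ‖x - y‖ := by
        refine mul_le_mul_of_nonneg_right ?_ (norm_nonneg _)
        rw [div_le_iff₀ (by positivity)]
        linarith
  have hmaps : Set.MapsTo F (closedBall x₀ ρ) (closedBall x₀ ρ) := fun x hx => by
    have h1 := hlip x hx x₀ (mem_closedBall_self hρ)
    rw [mem_closedBall_iff_norm] at hx ⊢
    calc ‖F x - x₀‖ ≤ ‖F x - F x₀‖ + ‖F x₀ - x₀‖ := norm_sub_le_norm_sub_add_norm_sub _ _ _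
      _ ≤ 1 / 2 * ρ + ρ / 2 := by
        gcongr
        exact h1.trans (by gcongr)
      _ = ρ := by ring
  have hcontr : ContractingWith (1 / 2) (hmaps.restrict F (closedBall x₀ ρ) (closedBall x₀ ρ)) := by
    refine ⟨by norm_num, LipschitzWith.of_dist_le_mul fun x y => ?_⟩
    simpa [Subtype.dist_eq, dist_eq_norm] using hlip x x.2 y y.2
  obtain ⟨x, hx, hfix, -⟩ := hcontr.exists_fixedPoint' isClosed_closedBall.isComplete hmaps
    (mem_closedBall_self hρ) (edist_ne_top _ _)
  exact ⟨x, hx, hfix.symm⟩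

/-- Comparison principle: `y` lies below `x` if both are positive solutions of
`x_i ((A x)_i - (A e)_i) = Q_i` and the components of `x` are large enough. -/
theorem le_of_mul_mulVec_sub_eq {A : Matrix ι ι ℝ} (hoff : ∀ i j, i ≠ j → A i j ≤ 0)
    {e Q x y : ι → ℝ} (he : ∀ i, 0 < e i)
    (hx : ∀ i, 0 < x i) (hxQ : ∀ i, x i * ((A *ᵥ x) i - (A *ᵥ e) i) = Q i)
    (hy : ∀ i, 0 < y i) (hyQ : ∀ i, y i * ((A *ᵥ y) i - (A *ᵥ e) i) = Q i)
    (hc : ∀ i, 0 < (A *ᵥ e) i) (hQ : ∀ i, -Q i * e i < (A *ᵥ e) i * x i ^ 2) : y ≤ x := by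
  intro j
  by_contra! hj
  -- With `t` the maximal ratio, x + t e lies above `y` and touches it at `i`, so row `i` of `A`
  -- applied to x + t e - y is nonpositive. The two equations then force (A e)_i x_i y_i ≤ -Q_i e_i,
  -- against `hQ` and x_i ≤ y_i.
  obtain ⟨i, -, hi⟩ := Finset.univ.exists_max_image (fun i => (y i - x i) / e i)
    ⟨j, Finset.mem_univ j⟩
  set t := (y i - x i) / e i with ht
  have htpos : 0 < t := (div_pos (sub_pos.2 hj) (he j)).trans_le (hi j (Finset.mem_univ j))
  have hyi : y i = x i + t * e i := by
    have := (he i).ne'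
    rw [ht]
    field_simp
    ring
  have hle : (A *ᵥ (x + t • e - y)) i ≤ 0 := by
    refine Finset.sum_nonpos fun k _ => ?_
    rcases eq_or_ne i k with rfl | hik
    · simp [hyi]
    · refine mul_nonpos_of_nonpos_of_nonneg (hoff i k hik) ?_
      have := (div_le_iff₀ (he k)).1 (hi k (Finset.mem_univ k))
      simp only [Pi.sub_apply, Pi.add_apply, Pi.smul_apply, smul_eq_mul]
      linarith
  rw [Matrix.mulVec_sub, Matrix.mulVec_add, Matrix.mulVec_smul] at hle
  simp only [Pi.sub_apply, Pi.add_apply, Pi.smul_apply, smul_eq_mul] at hle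
  have h1 := hxQ i
  have h2 := hyQ i
  have h3 := hQ i
  have hxi := hx i
  have hci := hc i
  have hxy : 0 < x i * y i := mul_pos hxi (hy i)
  have h4 : (A *ᵥ e) i * (x i * y i) * t ≤ -Q i * e i * t := by
    have := mul_le_mul_of_nonneg_left hle hxy.le
    have e1 : Q i * x i = x i * (y i * ((A *ᵥ y) i - (A *ᵥ e) i)) := by rw [h2]; ring
    have e2 : Q i * y i = y i * (x i * ((A *ᵥ x) i - (A *ᵥ e) i)) := by rw [h1]; ring
    have e3 : Q i * (t * e i) = Q i * y i - Q i * x i := by rw [hyi]; ring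
    linarith
  have h5 := le_of_mul_le_mul_right h4 htpos
  have h6 : (A *ᵥ e) i * x i ^ 2 ≤ (A *ᵥ e) i * (x i * y i) := by
    rw [sq]
    gcongr
    rw [hyi]
    linarith [mul_pos htpos (he i)]
  linarith

variable [DecidableEq ι]

/-- Perturbation of the solution `e` of `x_i ((A x)_i - (A e)_i) = Q_i` for small `Q`. -/
theorem exists_greatest_mul_mulVec_sub_eq {A : Matrix ι ι ℝ} (hA : IsUnit A.det)
    (hoff : ∀ i j, i ≠ j → A i j ≤ 0) {e : ι → ℝ} (hc : ∀ i, 0 < (A *ᵥ e) i) {r : ℝ} (hr : 0 < r)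
    (he : ∀ i, 3 * r ≤ e i) :
    ∃ δ > 0, ∃ C ≥ 0, ∀ Q : ι → ℝ, ‖Q‖ < δ →
      ∃ x : ι → ℝ, (∀ i, 0 < x i) ∧ (∀ i, x i * ((A *ᵥ x) i - (A *ᵥ e) i) = Q i) ∧
        ‖x - e‖ < r ∧
        (∀ y : ι → ℝ, (∀ i, 0 < y i) → (∀ i, y i * ((A *ᵥ y) i - (A *ᵥ e) i) = Q i) →
          y ≤ x ∧ (‖y - e‖ < r → y = x)) ∧
        ‖x - e - A⁻¹ *ᵥ (Q / e)‖ ≤ C * ‖Q‖ ^ 2 := by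
  have hepos : ∀ i, 0 < e i := fun i => by linarith [he i]
  obtain ⟨p, hp0, hp⟩ := A⁻¹.exists_norm_mulVec_le
  obtain ⟨g, hg0, hg⟩ := exists_pos_forall_ge (f := fun i => (A *ᵥ e) i * r ^ 2 / e i)
    fun i => div_pos (mul_pos (hc i) (by positivity)) (hepos i)
  -- The bound `g` supplies the comparison hypothesis for vectors with components at least `r`; the
  -- other bound makes the fixed point map contract.
  refine ⟨min g (r ^ 2 / (4 * p)), lt_min hg0 (by positivity), p * (1 / r ^ 2) * (p / r),
    by positivity, fun Q hQ => ?_⟩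
  have hQg : ‖Q‖ < g := hQ.trans_le (min_le_left _ _)
  have hQp : p * ‖Q‖ ≤ r ^ 2 / 4 := by
    have := (hQ.trans_le (min_le_right _ _)).le
    rw [le_div_iff₀ (by positivity)] at this
    linarith
  have her : ∀ i, r ≤ e i := fun i => by linarith [he i]
  have hstep : ‖A⁻¹ *ᵥ (Q / e)‖ ≤ r / 4 := by
    calc ‖A⁻¹ *ᵥ (Q / e)‖ ≤ p * (‖Q‖ / r) := (hp _).trans (by
          gcongr; exact Pi.norm_div_le_of_le hr her)
      _ = p * ‖Q‖ / r := by ring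
      _ ≤ r ^ 2 / 4 / r := by gcongr
      _ = r / 4 := by field_simp
  -- Radius r / 2 makes the later inequality ‖x - e‖ < r strict.
  obtain ⟨x, hxm, hxe⟩ := exists_eq_add_mulVec_div (ρ := r / 2) (x₀ := e) (u := e) (Q := Q)
    hp0.le hp hr (by positivity) (fun i => by linarith [he i]) (by linarith [sq_nonneg r])
    (by simpa using hstep.trans (by linarith))
  have hge : ∀ y : ι → ℝ, ‖y - e‖ < r → ∀ i, r ≤ y i := fun y hy i => by
    have h1 := (norm_le_pi_norm (y - e) i).trans hy.le
    have h2 := neg_abs_le ((y - e) i)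
    rw [Real.norm_eq_abs] at h1
    have h3 := he i
    simp only [Pi.sub_apply] at h1 h2
    linarith
  have hxr : ‖x - e‖ < r := (mem_closedBall_iff_norm.1 hxm).trans_lt (by linarith)
  have hxge := hge x hxr
  have hxpos : ∀ i, 0 < x i := fun i => hr.trans_le (hxge i)
  have hAx : A *ᵥ x = A *ᵥ e + Q / x := by
    conv_lhs => rw [hxe]
    rw [Matrix.mulVec_add, Matrix.mulVec_mulVec, Matrix.mul_nonsing_inv A hA, Matrix.one_mulVec]
  have hxQ : ∀ i, x i * ((A *ᵥ x) i - (A *ᵥ e) i) = Q i := fun i => by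
    rw [hAx]
    have := (hxpos i).ne'
    simp only [Pi.add_apply, Pi.div_apply]
    field_simp
    ring
  have hsmall : ∀ y : ι → ℝ, (∀ i, r ≤ y i) → ∀ i, -Q i * e i < (A *ᵥ e) i * y i ^ 2 :=
    fun y hy i => by
      have h1 : -Q i < (A *ᵥ e) i * r ^ 2 / e i :=
        ((neg_le_abs _).trans (norm_le_pi_norm Q i)).trans_lt (hQg.trans_le (hg i))
      rw [lt_div_iff₀ (hepos i)] at h1
      refine h1.trans_le ?_
      have := hc i
      have := hy i
      gcongr
  refine ⟨x, hxpos, hxQ, hxr, fun y hy hyQ => ?_, ?_⟩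
  · have h1 := le_of_mul_mulVec_sub_eq hoff hepos hxpos hxQ hy hyQ hc (hsmall x hxge)
    -- A solution near `e` also has components at least `r`, so the comparison works with the roles
    -- exchanged.
    exact ⟨h1, fun hyr => le_antisymm h1
      (le_of_mul_mulVec_sub_eq hoff hepos hy hyQ hxpos hxQ hc (hsmall y (hge y hyr)))⟩
  · have hxe' : x - e = A⁻¹ *ᵥ (Q / x) := sub_eq_iff_eq_add'.2 hxe
    have h1 : ‖x - e‖ ≤ p * (‖Q‖ / r) := by
      rw [hxe']
      exact (hp _).trans (by gcongr; exact Pi.norm_div_le_of_le hr hxge)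
    -- The remainder carries one factor ‖Q‖ explicitly and a second one through ‖x - e‖.
    rw [show x - e - A⁻¹ *ᵥ (Q / e) = A⁻¹ *ᵥ (Q / x - Q / e) by rw [Matrix.mulVec_sub, hxe']]
    calc ‖A⁻¹ *ᵥ (Q / x - Q / e)‖ ≤ p * (‖Q‖ / r ^ 2 * ‖x - e‖) := (hp _).trans (by
          gcongr; exact Pi.norm_div_sub_div_le hr hxge her)
      _ ≤ p * (‖Q‖ / r ^ 2 * (p * (‖Q‖ / r))) := by gcongr
      _ = p * (1 / r ^ 2) * (p / r) * ‖Q‖ ^ 2 := by ring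

end PowerFlow

/-! ### Global forward solutions of ordinary differential equations. -/

section GlobalSolutions

open Set Metric
open scoped NNReal

variable {E : Type*} [NormedAddCommGroup E] [NormedSpace ℝ E] [CompleteSpace E]

/-- Speed at most `L` confines the solution to the ball of radius L T, so Picard–Lindelöf reaches
any `T`. -/
theorem exists_hasDerivWithinAt_Icc_of_lipschitzWith {f : E → E} {K : ℝ≥0}
    (hf : LipschitzWith K f) {L : ℝ≥0} (hL : ∀ x, ‖f x‖ ≤ L) (x₀ : E) {T : ℝ} (hT : 0 ≤ T) :
    ∃ α : ℝ → E, α 0 = x₀ ∧ ∀ t ∈ Icc 0 T, HasDerivWithinAt α (f (α t)) (Icc 0 T) t := by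
  have h : IsPicardLindelof (fun _ => f) (tmin := 0) (tmax := T) ⟨0, left_mem_Icc.2 hT⟩ x₀
      (L * T.toNNReal) 0 L K :=
    .of_time_independent (fun x _ => hL x) hf.lipschitzOnWith (by simp [Real.coe_toNNReal T hT, hT])
  exact h.exists_eq_forall_mem_Icc_hasDerivWithinAt₀

/-- Global forward solutions for bounded Lipschitz vector fields. -/
theorem exists_hasDerivWithinAt_Ici_of_lipschitzWith {f : E → E} {K : ℝ≥0}
    (hf : LipschitzWith K f) {L : ℝ≥0} (hL : ∀ x, ‖f x‖ ≤ L) (x₀ : E) :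
    ∃ α : ℝ → E, α 0 = x₀ ∧ ∀ t ∈ Ici 0, HasDerivWithinAt α (f (α t)) (Ici 0) t := by
  choose α h0 hα using fun N : ℕ =>
    exists_hasDerivWithinAt_Icc_of_lipschitzWith hf hL x₀ N.cast_nonneg
  have huniq : ∀ M N : ℕ, M ≤ N → EqOn (α M) (α N) (Icc 0 M) := by
    intro M N hMN
    have hMN' : (M : ℝ) ≤ N := by exact_mod_cast hMN
    have hder : ∀ k : ℕ, M ≤ k → ∀ t ∈ Ico (0 : ℝ) M,
        HasDerivWithinAt (α k) (f (α k t)) (Ici t) t := fun k hk t ht => by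
      have hk' : (M : ℝ) ≤ k := by exact_mod_cast hk
      refine (hα k t ⟨ht.1, ht.2.le.trans hk'⟩).mono_of_mem_nhdsWithin ?_
      exact Filter.mem_of_superset (Icc_mem_nhdsGE (ht.2.trans_le hk')) (Icc_subset_Icc_left ht.1)
    refine ODE_solution_unique_of_mem_Icc_right (v := fun _ => f) (s := fun _ => univ)
      (fun _ _ => hf.lipschitzOnWith)
      (fun t ht => (hα M t ht).continuousWithinAt) (hder M le_rfl) (fun _ _ => mem_univ _)
      (fun t ht => ((hα N t ⟨ht.1, ht.2.trans hMN'⟩).mono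
        (Icc_subset_Icc_right hMN')).continuousWithinAt) (hder N hMN) (fun _ _ => mem_univ _) ?_
    rw [h0, h0]
  -- By uniqueness the glued function equals `α N` on all of [0, N), a neighbourhood of `t` in [0,
  -- ∞) once N > t.
  refine ⟨fun t => α (⌈t⌉₊ + 1) t, by simp [h0], fun t ht => ?_⟩
  set N := ⌈t⌉₊ + 2 with hN
  have htN : t < N := by
    have := Nat.le_ceil t
    simp only [hN]
    push_cast
    linarith
  have heq : ∀ s ∈ Ico (0 : ℝ) N, α (⌈s⌉₊ + 1) s = α N s := fun s hs => by
    have hs' := Nat.le_ceil s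
    rcases le_total (⌈s⌉₊ + 1) N with h | h
    · exact huniq _ _ h ⟨hs.1, by push_cast; linarith⟩
    · exact (huniq _ _ h ⟨hs.1, hs.2.le⟩).symm
  have hnhds : Ico (0 : ℝ) N ∈ nhdsWithin t (Ici 0) := by
    rw [← Ici_inter_Iio]
    exact inter_mem_nhdsWithin _ (Iio_mem_nhds htN)
  have h1 : HasDerivWithinAt (α N) (f (α N t)) (Ici 0) t :=
    (hα N t ⟨ht, htN.le⟩).mono_of_mem_nhdsWithin (Filter.mem_of_superset hnhds Ico_subset_Icc_self)
  have htm : t ∈ Ico (0 : ℝ) N := ⟨ht, htN⟩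
  have h2 := h1.congr_of_eventuallyEq (f₁ := fun t => α (⌈t⌉₊ + 1) t)
    (Filter.mem_of_superset hnhds heq) (heq t htm)
  simpa only [heq t htm] using h2

end GlobalSolutions

/-! ### Continuity argument for invariance, and Grönwall decay. -/

section Trapping

open Set

/-- A continuous function starting below `σ` stays below `σ` if it cannot reach `σ` first. -/
theorem ContinuousOn.forall_lt_of_forall_le_imp_lt {f : ℝ → ℝ} {T σ : ℝ}
    (hf : ContinuousOn f (Ico 0 T)) (h0 : f 0 < σ)
    (h : ∀ s ∈ Ico 0 T, (∀ t ∈ Icc 0 s, f t ≤ σ) → f s < σ) : ∀ s ∈ Ico 0 T, f s < σ := by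
  intro s hs
  by_contra! hcon
  -- The infimum of `S` is the first time at which `σ` is reached; there f ≤ σ still holds by
  -- continuity, which contradicts `h`.
  set S := Icc 0 s ∩ f ⁻¹' Ici σ with hS
  have hcl : IsClosed S :=
    (hf.mono (Icc_subset_Ico_right hs.2)).preimage_isClosed_of_isClosed isClosed_Icc isClosed_Ici
  have hne : S.Nonempty := ⟨s, ⟨hs.1, le_rfl⟩, hcon⟩
  have hbdd : BddBelow S := ⟨0, fun t ht => ht.1.1⟩
  have hm := hcl.csInf_mem hne hbdd
  set t₀ := sInf S
  have hlt : ∀ t ∈ Ico 0 t₀, f t < σ := fun t ht => by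
    by_contra! hge
    exact (csInf_le hbdd ⟨⟨ht.1, ht.2.le.trans hm.1.2⟩, hge⟩).not_gt ht.2
  have ht₀ : 0 < t₀ := lt_of_le_of_ne hm.1.1 fun h' => by
    have : σ ≤ f t₀ := hm.2
    rw [← h'] at this
    linarith
  have ht₀T : t₀ ∈ Ico 0 T := ⟨ht₀.le, hm.1.2.trans_lt hs.2⟩
  have hle : f t₀ ≤ σ := by
    have hmem : t₀ ∈ closure (Ico 0 t₀) := by
      rw [closure_Ico ht₀.ne]
      exact right_mem_Icc.2 ht₀.le
    refine ((hf t₀ ht₀T).mono (Ico_subset_Ico_right ht₀T.2.le)).closure_le hmem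
      continuousWithinAt_const fun t ht => (hlt t ht).le
  have := h t₀ ht₀T fun t ht => by
    rcases ht.2.eq_or_lt with rfl | h'
    · exact hle
    · exact (hlt t ⟨ht.1, h'⟩).le
  exact absurd hm.2 (not_le.2 this)

/-- Grönwall's inequality with constant -k; it needs only right derivatives. -/
theorem le_mul_exp_of_hasDerivWithinAt_le {W W' : ℝ → ℝ} {k T s : ℝ} (hs : s ∈ Ico 0 T)
    (hW : ∀ t ∈ Icc 0 s, HasDerivWithinAt W (W' t) (Ico 0 T) t)
    (hle : ∀ t ∈ Icc 0 s, W' t ≤ -k * W t) : W s ≤ W 0 * Real.exp (-k * s) := by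
  have h := le_gronwallBound_of_liminf_deriv_right_le (f := W) (f' := W') (δ := W 0) (K := -k)
    (ε := 0) (a := 0) (b := s)
    (fun t ht => ((hW t ht).continuousWithinAt.mono (Icc_subset_Ico_right hs.2)))
    (fun t ht r hr => by
      have : HasDerivWithinAt W (W' t) (Ici t) t :=
        (hW t (Ico_subset_Icc_self ht)).mono_of_mem_nhdsWithin
          (Filter.mem_of_superset (Ico_mem_nhdsGE (ht.2.trans hs.2)) (Ico_subset_Ico_left ht.1))
      exact this.liminf_right_slope_le hr)
    le_rfl (fun t ht => by simpa using hle t (Ico_subset_Icc_self ht)) s ⟨hs.1, le_rfl⟩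
  simpa [gronwallBound_ε0] using h

end Trapping

/-! ### Structure of the network matrices and reduction to the load buses. -/

namespace Microgrid

open Matrix

variable {n m : ℕ} (M : Microgrid n m)

theorem b_nonpos (i j : Fin n ⊕ Fin m) : M.b i j ≤ 0 := by
  by_cases h : M.graph.Adj i j
  · exact (M.b_neg i j h).le
  · exact (M.b_zero i j h).le

theorem B_apply_nonneg {i j : Fin n ⊕ Fin m} (hij : i ≠ j) : 0 ≤ M.B i j := by
  simp [B, hij, M.b_nonpos i j]

theorem B_isSymm : M.B.IsSymm := by
  ext i j
  rcases eq_or_ne i j with rfl | hij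
  · rfl
  · simp [B, hij, hij.symm, M.b_symm i j]

theorem B_mulVec_apply (v : Fin n ⊕ Fin m → ℝ) (i : Fin n ⊕ Fin m) :
    (M.B *ᵥ v) i = ∑ j, M.b i j * (v i - v j) := by
  rw [mulVec, dotProduct, ← Finset.add_sum_erase _ _ (Finset.mem_univ i),
    ← Finset.add_sum_erase _ (fun j => M.b i j * (v i - v j)) (Finset.mem_univ i)]
  simp only [B, of_apply, if_true, sub_self, mul_zero, zero_add, Finset.sum_mul,
    ← Finset.sum_add_distrib]
  refine Finset.sum_congr rfl fun j hj => ?_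
  rw [if_neg (Finset.ne_of_mem_erase hj).symm]
  ring

/-- `B` is the graph Laplacian with the nonpositive weights `b`; averaging the double sum with its
transpose produces the squares. -/
theorem dotProduct_B_mulVec (v : Fin n ⊕ Fin m → ℝ) :
    v ⬝ᵥ M.B *ᵥ v = (∑ i, ∑ j, M.b i j * (v i - v j) ^ 2) / 2 := by
  have h1 : v ⬝ᵥ M.B *ᵥ v = ∑ i, ∑ j, M.b i j * (v i - v j) * v i := by
    simp only [dotProduct, M.B_mulVec_apply, Finset.mul_sum]
    exact Finset.sum_congr rfl fun i _ => Finset.sum_congr rfl fun j _ => by ring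
  have h2 : v ⬝ᵥ M.B *ᵥ v = ∑ i, ∑ j, -(M.b i j * (v i - v j) * v j) := by
    rw [h1, Finset.sum_comm]
    refine Finset.sum_congr rfl fun i _ => Finset.sum_congr rfl fun j _ => ?_
    rw [M.b_symm j i]
    ring
  rw [eq_div_iff two_ne_zero, mul_two]
  nth_rw 1 [h1]
  rw [h2, ← Finset.sum_add_distrib]
  refine Finset.sum_congr rfl fun i _ => ?_
  rw [← Finset.sum_add_distrib]
  exact Finset.sum_congr rfl fun j _ => by ring

/-- The susceptance matrix with shunt susceptances `β` at the loads and the controller gains at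
the inverters added to its diagonal. -/
def shuntedB (β : Fin n → ℝ) : Matrix (Fin n ⊕ Fin m) (Fin n ⊕ Fin m) ℝ :=
  M.B + diagonal (Sum.elim β M.K)

theorem shuntedB_isSymm (β : Fin n → ℝ) : (M.shuntedB β).IsSymm :=
  M.B_isSymm.add (isSymm_diagonal _)

theorem shuntedB_mulVec_inl (β : Fin n → ℝ) (v : Fin n ⊕ Fin m → ℝ) (i : Fin n) :
    (M.shuntedB β *ᵥ v) (Sum.inl i) = (M.B *ᵥ v) (Sum.inl i) + β i * v (Sum.inl i) := by
  simp [shuntedB, add_mulVec, mulVec_diagonal]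

theorem shuntedB_mulVec_inr (β : Fin n → ℝ) (v : Fin n ⊕ Fin m → ℝ) (i : Fin m) :
    (M.shuntedB β *ᵥ v) (Sum.inr i) = (M.B *ᵥ v) (Sum.inr i) + M.K i * v (Sum.inr i) := by
  simp [shuntedB, add_mulVec, mulVec_diagonal]

/-- If the form vanishes at `v`, then `v` is constant along branches, hence constant by
connectedness, and the negative gain at some inverter forces the constant to be zero. -/
theorem neg_shuntedB_zero_posDef (hm : 1 ≤ m) : (-M.shuntedB 0).PosDef := by
  refine .of_dotProduct_mulVec_pos ?_ fun v hv => ?_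
  · rw [IsHermitian, conjTranspose_eq_transpose_of_trivial]
    exact (M.shuntedB_isSymm 0).neg
  have hB : ∀ i ∈ Finset.univ, ∑ j, M.b i j * (v i - v j) ^ 2 ≤ 0 := fun i _ =>
    Finset.sum_nonpos fun j _ => mul_nonpos_of_nonpos_of_nonneg (M.b_nonpos i j) (sq_nonneg _)
  have hK : ∀ i ∈ Finset.univ, M.K i * v (Sum.inr i) ^ 2 ≤ 0 := fun i _ =>
    mul_nonpos_of_nonpos_of_nonneg (M.K_neg i).le (sq_nonneg _)
  have e : star v ⬝ᵥ (-M.shuntedB 0) *ᵥ v =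
      -((∑ i, ∑ j, M.b i j * (v i - v j) ^ 2) / 2) + -∑ i, M.K i * v (Sum.inr i) ^ 2 := by
    rw [← M.dotProduct_B_mulVec v, star_trivial, shuntedB, neg_mulVec, dotProduct_neg, add_mulVec,
      dotProduct_add, neg_add, add_right_inj, neg_inj]
    simp only [dotProduct, mulVec_diagonal, Fintype.sum_sum_type, Sum.elim_inl, Sum.elim_inr,
      Pi.zero_apply, zero_mul, mul_zero, Finset.sum_const_zero, zero_add]
    exact Finset.sum_congr rfl fun i _ => by ring
  rw [e]
  have h1 := Finset.sum_nonpos hB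
  have h2 := Finset.sum_nonpos hK
  by_contra! hle
  have hB0 : ∑ i, ∑ j, M.b i j * (v i - v j) ^ 2 = 0 := by linarith
  have hK0 : ∑ i, M.K i * v (Sum.inr i) ^ 2 = 0 := by linarith
  have hadj : ∀ i j, M.graph.Adj i j → v i = v j := fun i j hij => by
    have := (Finset.sum_eq_zero_iff_of_nonpos fun j _ =>
      mul_nonpos_of_nonpos_of_nonneg (M.b_nonpos i j) (sq_nonneg (v i - v j))).1
      ((Finset.sum_eq_zero_iff_of_nonpos hB).1 hB0 i (Finset.mem_univ i)) j (Finset.mem_univ j)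
    have := (mul_eq_zero.1 this).resolve_left (M.b_neg i j hij).ne
    exact sub_eq_zero.1 (pow_eq_zero_iff two_ne_zero |>.1 this)
  have hconst : ∀ i j, v i = v j := fun i j => by
    obtain ⟨w⟩ := M.connected.preconnected i j
    induction w with
    | nil => rfl
    | cons h _ ih => exact (hadj _ _ h).trans ih
  have h0 : v (Sum.inr ⟨0, hm⟩) = 0 := by
    have := (Finset.sum_eq_zero_iff_of_nonpos hK).1 hK0 ⟨0, hm⟩ (Finset.mem_univ _)
    have := (mul_eq_zero.1 this).resolve_left (M.K_neg _).ne
    exact pow_eq_zero_iff two_ne_zero |>.1 this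
  exact hv (funext fun i => (hconst i _).trans h0)

theorem BIL_eq_transpose : M.BIL = M.BLIᵀ := by
  ext i j
  exact M.B_isSymm.apply (Sum.inl j) (Sum.inr i)

theorem neg_shuntedB_eq_fromBlocks (β : Fin n → ℝ) :
    -M.shuntedB β =
      fromBlocks (-(M.BLL + diagonal β)) (-M.BLI) (-M.BLI)ᵀ (-(M.BII + M.KI)) := by
  rw [transpose_neg, ← BIL_eq_transpose]
  ext (i | i) (j | j) <;>
    simp [shuntedB, BLL, BLI, BIL, BII, KI, toBlocks₁₁, toBlocks₁₂, toBlocks₂₁, toBlocks₂₂,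
      diagonal_apply] <;> split_ifs <;> simp

theorem neg_BII_add_KI_posDef (hm : 1 ≤ m) : (-(M.BII + M.KI)).PosDef := by
  have h := (M.neg_shuntedB_zero_posDef hm).submatrix (e := Sum.inr) Sum.inr_injective
  rw [neg_shuntedB_eq_fromBlocks] at h
  exact h

theorem isUnit_det_BII_add_KI (hm : 1 ≤ m) : IsUnit (M.BII + M.KI).det := by
  rw [← isUnit_iff_isUnit_det, ← neg_neg (M.BII + M.KI)]
  exact (M.neg_BII_add_KI_posDef hm).isUnit.neg

/-- The link between the reduced and the full network: symmetry and definiteness pass between the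
two through this Schur complement. -/
theorem neg_Bred_add_diagonal_eq_schur (hm : 1 ≤ m) (β : Fin n → ℝ) :
    -(M.Bred + diagonal β) =
      -(M.BLL + diagonal β) - (-M.BLI) * (-(M.BII + M.KI))⁻¹ * (-M.BLI)ᵀ := by
  have h : (-(M.BII + M.KI))⁻¹ = -(M.BII + M.KI)⁻¹ := by
    refine inv_eq_left_inv ?_
    rw [neg_mul_neg, nonsing_inv_mul _ (M.isUnit_det_BII_add_KI hm)]
  rw [h, Bred, BIL_eq_transpose]
  simp only [transpose_neg, Matrix.neg_mul, Matrix.mul_neg, neg_neg]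
  abel

theorem neg_Bred_add_diagonal_isHermitian (hm : 1 ≤ m) (β : Fin n → ℝ) :
    (-(M.Bred + diagonal β)).IsHermitian := by
  rw [M.neg_Bred_add_diagonal_eq_schur hm, ← conjTranspose_eq_transpose_of_trivial,
    ← IsHermitian.fromBlocks₂₂ _ _ (M.neg_BII_add_KI_posDef hm).isHermitian,
    conjTranspose_eq_transpose_of_trivial, ← neg_shuntedB_eq_fromBlocks, IsHermitian,
    conjTranspose_eq_transpose_of_trivial]
  exact (M.shuntedB_isSymm β).neg

theorem neg_shuntedB_posDef (hm : 1 ≤ m) {β : Fin n → ℝ} (h : (-(M.Bred + diagonal β)).PosDef) :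
    (-M.shuntedB β).PosDef := by
  rw [M.neg_shuntedB_eq_fromBlocks]
  refine (M.neg_BII_add_KI_posDef hm).fromBlocks_of_schur ?_
  rwa [← M.neg_Bred_add_diagonal_eq_schur hm]

theorem isUnit_det_Bred (hm : 1 ≤ m) : IsUnit M.Bred.det := by
  have h := (isUnit_iff_isUnit_det _).1 (M.neg_shuntedB_zero_posDef hm).isUnit
  let _ := (M.neg_BII_add_KI_posDef hm).isUnit.invertible
  rw [neg_shuntedB_eq_fromBlocks, det_fromBlocks₂₂, invOf_eq_nonsing_inv,
    ← M.neg_Bred_add_diagonal_eq_schur hm] at h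
  have h := isUnit_of_mul_isUnit_right h
  rw [← isUnit_iff_isUnit_det, diagonal_zero', add_zero] at h
  rw [← isUnit_iff_isUnit_det, ← neg_neg M.Bred]
  exact h.neg

theorem Bred_mulVec_Eopen (hm : 1 ≤ m) :
    M.Bred *ᵥ M.Eopen = -(M.BLI *ᵥ (M.BII + M.KI)⁻¹ *ᵥ M.KI *ᵥ M.Eset) := by
  rw [Eopen, W₁, mulVec_mulVec, Matrix.mul_neg, ← Matrix.mul_assoc, ← Matrix.mul_assoc,
    ← Matrix.mul_assoc, mul_nonsing_inv _ (M.isUnit_det_Bred hm), Matrix.one_mul, neg_mulVec]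
  simp only [mulVec_mulVec, Matrix.mul_assoc]

theorem inverterVoltages_eq (x : Fin n → ℝ) :
    M.inverterVoltages x = (M.BII + M.KI)⁻¹ *ᵥ (M.KI *ᵥ M.Eset - M.BIL *ᵥ x) := by
  rw [inverterVoltages, W₂, ← mulVec_mulVec, fromCols_mulVec_sumElim, neg_mulVec, sub_eq_neg_add]

theorem B_mulVec_inl (x : Fin n → ℝ) (y : Fin m → ℝ) (i : Fin n) :
    (M.B *ᵥ Sum.elim x y) (Sum.inl i) = (M.BLL *ᵥ x + M.BLI *ᵥ y) i := by
  simp [mulVec, dotProduct, Fintype.sum_sum_type, BLL, BLI, toBlocks₁₁, toBlocks₁₂]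

theorem B_mulVec_inr (x : Fin n → ℝ) (y : Fin m → ℝ) (i : Fin m) :
    (M.B *ᵥ Sum.elim x y) (Sum.inr i) = (M.BIL *ᵥ x + M.BII *ᵥ y) i := by
  simp [mulVec, dotProduct, Fintype.sum_sum_type, BIL, BII, toBlocks₂₁, toBlocks₂₂]

/-- Kron reduction: eliminating the inverter voltages from the load rows leaves the reduced
equation. -/
theorem B_mulVec_inverterVoltages_inl (hm : 1 ≤ m) (x : Fin n → ℝ) (i : Fin n) :
    (M.B *ᵥ Sum.elim x (M.inverterVoltages x)) (Sum.inl i) = (M.Bred *ᵥ (x - M.Eopen)) i := by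
  rw [B_mulVec_inl, mulVec_sub, Bred_mulVec_Eopen M hm, inverterVoltages_eq, Bred, sub_mulVec,
    mulVec_sub, mulVec_sub]
  simp only [mulVec_mulVec, Matrix.mul_assoc, Pi.add_apply, Pi.sub_apply, Pi.neg_apply]
  ring

theorem BII_add_KI_mulVec_inverterVoltages (hm : 1 ≤ m) (x : Fin n → ℝ) :
    (M.BII + M.KI) *ᵥ M.inverterVoltages x = M.KI *ᵥ M.Eset - M.BIL *ᵥ x := by
  rw [inverterVoltages_eq, mulVec_mulVec, mul_nonsing_inv _ (M.isUnit_det_BII_add_KI hm),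
    one_mulVec]

theorem B_mulVec_inverterVoltages_inr (hm : 1 ≤ m) (x : Fin n → ℝ) (i : Fin m) :
    M.K i * (M.inverterVoltages x i - M.Eset i) +
      (M.B *ᵥ Sum.elim x (M.inverterVoltages x)) (Sum.inr i) = 0 := by
  have h := congrFun (M.BII_add_KI_mulVec_inverterVoltages hm x) i
  rw [add_mulVec] at h
  simp only [KI, mulVec_diagonal, Pi.add_apply, Pi.sub_apply] at h
  rw [B_mulVec_inr, Pi.add_apply]
  linarith

/-- Inverse positivity of -(B_II + K_I), applied to the positive right-hand side B_IL x - K_I E_I^*.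
-/
theorem inverterVoltages_pos (hm : 1 ≤ m) {x : Fin n → ℝ} (hx : ∀ i, 0 < x i) (i : Fin m) :
    0 < M.inverterVoltages x i := by
  refine (M.neg_BII_add_KI_posDef hm).pos_of_mulVec_pos (fun i j hij => ?_) (fun i => ?_) i
  · have := M.B_apply_nonneg (i := Sum.inr i) (j := Sum.inr j) (by simpa using hij)
    simpa [KI, hij, BII, toBlocks₂₂] using this
  · rw [neg_mulVec, M.BII_add_KI_mulVec_inverterVoltages hm, neg_sub, Pi.sub_apply, sub_pos]
    calc (M.KI *ᵥ M.Eset) i < 0 := by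
          rw [KI, mulVec_diagonal]
          exact mul_neg_of_neg_of_pos (M.K_neg i) (M.Eset_pos i)
      _ ≤ ∑ j, M.BIL i j * x j := Finset.sum_nonneg fun j _ =>
        mul_nonneg (M.B_apply_nonneg (i := Sum.inr i) (j := Sum.inl j) (by simp)) (hx j).le

theorem closedLoop_inl (Q : Fin n → ℝ → ℝ) (E : Fin n ⊕ Fin m → ℝ) (i : Fin n) :
    M.closedLoop Q E (Sum.inl i) = Q i (E (Sum.inl i)) + E (Sum.inl i) * (M.B *ᵥ E) (Sum.inl i) :=
  rfl

theorem closedLoop_inr (Q : Fin n → ℝ → ℝ) (E : Fin n ⊕ Fin m → ℝ) (i : Fin m) :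
    M.closedLoop Q E (Sum.inr i) = E (Sum.inr i) *
      (M.K i * (E (Sum.inr i) - M.Eset i) + (M.B *ᵥ E) (Sum.inr i)) := by
  simp only [closedLoop, Pi.add_apply, Sum.elim_inr]
  ring

theorem IsPositiveReducedSolution.isEquilibrium {M : Microgrid n m} (hm : 1 ≤ m) {Q : Fin n → ℝ → ℝ}
    {x : Fin n → ℝ} (hx : M.IsPositiveReducedSolution Q x) :
    M.IsEquilibrium Q (Sum.elim x (M.inverterVoltages x)) := by
  refine ⟨?_, ?_⟩
  · rintro (i | i)
    · exact hx.1 i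
    · exact M.inverterVoltages_pos hm hx.1 i
  · funext i
    rcases i with i | i
    · rw [closedLoop_inl, B_mulVec_inverterVoltages_inl M hm]
      exact (hx.2 i).symm
    · rw [closedLoop_inr]
      simp [B_mulVec_inverterVoltages_inr M hm]

theorem isPositiveReducedSolution_zipLoad_iff {bsh Ish Q x : Fin n → ℝ} :
    M.IsPositiveReducedSolution (zipLoad bsh Ish Q) x ↔ (∀ i, 0 < x i) ∧
      ∀ i, x i * ((-(M.Bred + diagonal bsh) *ᵥ x) i - (Ish i - (M.Bred *ᵥ M.Eopen) i)) = Q i := by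
  refine and_congr_right fun _ => forall_congr' fun i => ?_
  rw [neg_mulVec, add_mulVec, mulVec_sub]
  simp only [zipLoad, Pi.neg_apply, Pi.add_apply, Pi.sub_apply, mulVec_diagonal]
  constructor <;> intro h <;> linarith

end Microgrid

/-! ### Dissipation, Lyapunov function and exponential decay. -/

namespace Microgrid

open Matrix Metric

variable {n m : ℕ} (M : Microgrid n m) {bsh Ish Q : Fin n → ℝ}

theorem dotProduct_comp_inr_le (v : Fin n ⊕ Fin m → ℝ) :
    (v ∘ Sum.inr) ⬝ᵥ (v ∘ Sum.inr) ≤ v ⬝ᵥ v := by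
  simp only [dotProduct, Fintype.sum_sum_type, Function.comp_apply, le_add_iff_nonneg_left]
  exact Finset.sum_nonneg fun i _ => mul_self_nonneg _

theorem closedLoop_zipLoad_inl_eq_zero_iff {E : Fin n ⊕ Fin m → ℝ} {i : Fin n}
    (hE : 0 < E (Sum.inl i)) : M.closedLoop (zipLoad bsh Ish Q) E (Sum.inl i) = 0 ↔
      (M.shuntedB bsh *ᵥ E) (Sum.inl i) = -Ish i - Q i / E (Sum.inl i) := by
  have e : M.closedLoop (zipLoad bsh Ish Q) E (Sum.inl i) = E (Sum.inl i) *
      ((M.shuntedB bsh *ᵥ E) (Sum.inl i) - (-Ish i - Q i / E (Sum.inl i))) := by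
    rw [closedLoop_inl, shuntedB_mulVec_inl, zipLoad]
    field_simp
    ring
  rw [e, mul_eq_zero, or_iff_right hE.ne', sub_eq_zero]

/-- Differences of states that satisfy the load equations are dissipated at the inverters. -/
theorem mul_dotProduct_sub_le {k a : ℝ}
    (hk : ∀ v, k * (v ⬝ᵥ v) ≤ v ⬝ᵥ (-M.shuntedB bsh) *ᵥ v) (ha : 0 < a)
    (hQ : ‖Q‖ ≤ k * a ^ 2 / 4) {E F : Fin n ⊕ Fin m → ℝ}
    (hE : ∀ i, a ≤ E (Sum.inl i)) (hF : ∀ i, a ≤ F (Sum.inl i))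
    (hEQ : ∀ i, M.closedLoop (zipLoad bsh Ish Q) E (Sum.inl i) = 0)
    (hFQ : ∀ i, M.closedLoop (zipLoad bsh Ish Q) F (Sum.inl i) = 0) :
    3 / 4 * k * ((E - F) ⬝ᵥ (E - F)) ≤
      -(((E - F) ∘ Sum.inr) ⬝ᵥ ((M.shuntedB bsh *ᵥ (E - F)) ∘ Sum.inr)) := by
  set v := E - F with hv
  have hload : ∀ i ∈ Finset.univ, -(v (Sum.inl i) * (M.shuntedB bsh *ᵥ v) (Sum.inl i)) ≤
      k / 4 * (v (Sum.inl i) * v (Sum.inl i)) := fun i _ => by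
    have hEi := ha.trans_le (hE i)
    have hFi := ha.trans_le (hF i)
    have h1 := (M.closedLoop_zipLoad_inl_eq_zero_iff hEi).1 (hEQ i)
    have h2 := (M.closedLoop_zipLoad_inl_eq_zero_iff hFi).1 (hFQ i)
    -- The constant currents cancel in the difference; only the constant power term survives, as a
    -- small multiple of `v`.
    have h3 : (M.shuntedB bsh *ᵥ v) (Sum.inl i) =
        Q i / (E (Sum.inl i) * F (Sum.inl i)) * v (Sum.inl i) := by
      rw [hv, mulVec_sub, Pi.sub_apply, Pi.sub_apply, h1, h2]
      field_simp
      ring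
    have h4 : -(Q i / (E (Sum.inl i) * F (Sum.inl i))) ≤ k / 4 := by
      rw [← neg_div, div_le_iff₀ (mul_pos hEi hFi)]
      have hk0 : 0 ≤ k := by
        have := (norm_nonneg Q).trans hQ
        by_contra! hneg
        have : k * a ^ 2 < 0 := mul_neg_of_neg_of_pos hneg (by positivity)
        linarith
      calc -Q i ≤ ‖Q‖ := (neg_le_abs _).trans (norm_le_pi_norm Q i)
        _ ≤ k / 4 * (a * a) := by linarith
        _ ≤ k / 4 * (E (Sum.inl i) * F (Sum.inl i)) := by
          have := hE i
          have := hF i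
          gcongr
    rw [h3]
    have := mul_le_mul_of_nonneg_right h4 (mul_self_nonneg (v (Sum.inl i)))
    linarith
  have hsum := Finset.sum_le_sum hload
  have hkv := hk v
  rw [neg_mulVec, dotProduct_neg] at hkv
  have e1 : v ⬝ᵥ v = ∑ i, v (Sum.inl i) * v (Sum.inl i) + (v ∘ Sum.inr) ⬝ᵥ (v ∘ Sum.inr) := by
    simp only [dotProduct, Fintype.sum_sum_type, Function.comp_apply]
  have e2 : v ⬝ᵥ M.shuntedB bsh *ᵥ v =
      ∑ i, v (Sum.inl i) * (M.shuntedB bsh *ᵥ v) (Sum.inl i) +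
        (v ∘ Sum.inr) ⬝ᵥ ((M.shuntedB bsh *ᵥ v) ∘ Sum.inr) := by
    simp only [dotProduct, Fintype.sum_sum_type, Function.comp_apply]
  have hinr : 0 ≤ (v ∘ Sum.inr) ⬝ᵥ (v ∘ Sum.inr) :=
    Finset.sum_nonneg fun i _ => mul_self_nonneg _
  have hk0 : 0 ≤ k := by
    by_contra! hneg
    have : k * a ^ 2 < 0 := mul_neg_of_neg_of_pos hneg (by positivity)
    linarith [(norm_nonneg Q).trans hQ]
  rw [Finset.sum_neg_distrib, ← Finset.mul_sum] at hsum
  have := mul_nonneg hk0 hinr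
  rw [e1] at hkv ⊢
  linarith

/-- States that satisfy the load equations depend Lipschitz continuously on the inverter
voltages. -/
theorem exists_norm_sub_le {k a : ℝ} (hk0 : 0 < k)
    (hk : ∀ v, k * (v ⬝ᵥ v) ≤ v ⬝ᵥ (-M.shuntedB bsh) *ᵥ v) (ha : 0 < a)
    (hQ : ‖Q‖ ≤ k * a ^ 2 / 4) : ∃ C > 0, ∀ E F : Fin n ⊕ Fin m → ℝ,
      (∀ i, a ≤ E (Sum.inl i)) → (∀ i, a ≤ F (Sum.inl i)) →
      (∀ i, M.closedLoop (zipLoad bsh Ish Q) E (Sum.inl i) = 0) →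
      (∀ i, M.closedLoop (zipLoad bsh Ish Q) F (Sum.inl i) = 0) →
      ‖E - F‖ ≤ C * ‖(E - F) ∘ Sum.inr‖ := by
  obtain ⟨S, hS0, hS⟩ := (M.shuntedB bsh).exists_norm_mulVec_le
  -- Dissipation gives (3/4) k ‖v‖² ≤ m ‖v_I‖ S ‖v‖, and one factor ‖v‖ cancels; m + 1 keeps the
  -- constant positive for m = 0.
  refine ⟨4 * (m + 1) * S / (3 * k), by positivity, fun E F hE hF hEQ hFQ => ?_⟩
  have h := M.mul_dotProduct_sub_le hk ha hQ hE hF hEQ hFQ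
  set v := E - F
  have h1 : -((v ∘ Sum.inr) ⬝ᵥ ((M.shuntedB bsh *ᵥ v) ∘ Sum.inr)) ≤
      m * (‖v ∘ Sum.inr‖ * (S * ‖v‖)) := by
    have : ∀ i ∈ (Finset.univ : Finset (Fin m)),
        -(v (Sum.inr i) * (M.shuntedB bsh *ᵥ v) (Sum.inr i)) ≤ ‖v ∘ Sum.inr‖ * (S * ‖v‖) :=
      fun i _ => by
        refine (neg_le_abs _).trans ?_
        rw [abs_mul]
        exact mul_le_mul (norm_le_pi_norm (v ∘ Sum.inr) i)
          ((norm_le_pi_norm _ (Sum.inr i)).trans (hS v)) (abs_nonneg _) (norm_nonneg _)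
    simpa [dotProduct] using Finset.sum_le_sum this
  have h2 := norm_sq_le_dotProduct_self v
  rcases (norm_nonneg v).eq_or_lt with h0 | h0
  · rw [← h0]
    positivity
  have h3 : 3 / 4 * k * ‖v‖ * ‖v‖ ≤ (m + 1) * S * ‖v ∘ Sum.inr‖ * ‖v‖ := by
    have h4 : 3 / 4 * k * ‖v‖ ^ 2 ≤ 3 / 4 * k * (v ⬝ᵥ v) := by gcongr
    have h5 : 0 ≤ S * ‖v ∘ Sum.inr‖ * ‖v‖ := by positivity
    nlinarith
  have h4 := le_of_mul_le_mul_right h3 h0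
  rw [div_mul_eq_mul_div, le_div_iff₀ (by positivity)]
  linarith

/-- The derivative of the Lyapunov function `∑ i, τ_i / y_i * (E_i - y_i) ^ 2`, where `y` are the
inverter voltages at equilibrium. -/
theorem sum_lyapunov_deriv_le {k a S g ρ : ℝ}
    (hk : ∀ v, k * (v ⬝ᵥ v) ≤ v ⬝ᵥ (-M.shuntedB bsh) *ᵥ v) (hk0 : 0 < k) (ha : 0 < a)
    (hQ : ‖Q‖ ≤ k * a ^ 2 / 4) (hS0 : 0 < S) (hS : ∀ v, ‖M.shuntedB bsh *ᵥ v‖ ≤ S * ‖v‖)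
    {E F : Fin n ⊕ Fin m → ℝ} (hF : M.IsEquilibrium (zipLoad bsh Ish Q) F)
    (hg : ∀ i, g ≤ F (Sum.inr i)) (hρ : 4 * (S * ρ) ≤ k * g)
    (hEa : ∀ i, a ≤ E (Sum.inl i)) (hFa : ∀ i, a ≤ F (Sum.inl i))
    (hEQ : ∀ i, M.closedLoop (zipLoad bsh Ish Q) E (Sum.inl i) = 0) (hEF : ‖E - F‖ ≤ ρ) :
    ∑ i, M.tau i / F (Sum.inr i) * (2 * (E - F) (Sum.inr i) *
      (M.closedLoop (zipLoad bsh Ish Q) E (Sum.inr i) / M.tau i)) ≤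
      -k * (((E - F) ∘ Sum.inr) ⬝ᵥ ((E - F) ∘ Sum.inr)) := by
  have h := M.mul_dotProduct_sub_le hk ha hQ hEa hFa hEQ fun i => congrFun hF.2 _
  set v := E - F with hv
  have hs : ∀ i, M.closedLoop (zipLoad bsh Ish Q) E (Sum.inr i) =
      E (Sum.inr i) * (M.shuntedB bsh *ᵥ v) (Sum.inr i) := fun i => by
    have h0 : M.closedLoop (zipLoad bsh Ish Q) F (Sum.inr i) = 0 := congrFun hF.2 _
    rw [closedLoop_inr, mul_eq_zero, or_iff_right (hF.1 _).ne'] at h0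
    rw [closedLoop_inr, shuntedB_mulVec_inr, hv, mulVec_sub, Pi.sub_apply, Pi.sub_apply]
    congr 1
    linarith
  have hterm : ∀ i ∈ Finset.univ, M.tau i / F (Sum.inr i) * (2 * v (Sum.inr i) *
      (M.closedLoop (zipLoad bsh Ish Q) E (Sum.inr i) / M.tau i)) ≤
      2 * (v (Sum.inr i) * (M.shuntedB bsh *ᵥ v) (Sum.inr i)) +
        k / 2 * (v (Sum.inr i) * v (Sum.inr i)) := fun i _ => by
    have hτ := (M.tau_pos i).ne'
    have hFi := hF.1 (Sum.inr i)
    -- The weight τ_i / F_i turns the factor E_i of the vector field into 1 + v_i / F_i: the leading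
    -- term is the dissipated one, and the cubic rest is absorbed by the smallness of `ρ`.
    have e : M.tau i / F (Sum.inr i) * (2 * v (Sum.inr i) *
        (M.closedLoop (zipLoad bsh Ish Q) E (Sum.inr i) / M.tau i)) =
        2 * (v (Sum.inr i) * (M.shuntedB bsh *ᵥ v) (Sum.inr i)) +
          2 * ((M.shuntedB bsh *ᵥ v) (Sum.inr i) / F (Sum.inr i)) *
            (v (Sum.inr i) * v (Sum.inr i)) := by
      rw [hs, show E (Sum.inr i) = F (Sum.inr i) + v (Sum.inr i) by simp [hv]]
      have := hFi.ne'
      field_simp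
    rw [e]
    have h1 : (M.shuntedB bsh *ᵥ v) (Sum.inr i) ≤ S * ρ :=
      (le_abs_self _).trans ((norm_le_pi_norm _ (Sum.inr i)).trans
        ((hS v).trans (by gcongr)))
    have h2 : (M.shuntedB bsh *ᵥ v) (Sum.inr i) / F (Sum.inr i) ≤ k / 4 := by
      rw [div_le_iff₀ hFi]
      have : k * g ≤ k * F (Sum.inr i) := by
        gcongr
        exact hg i
      linarith
    have := mul_le_mul_of_nonneg_right h2 (mul_self_nonneg (v (Sum.inr i)))
    linarith
  refine (Finset.sum_le_sum hterm).trans ?_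
  rw [Finset.sum_add_distrib, ← Finset.mul_sum, ← Finset.mul_sum]
  have h1 : k * ((v ∘ Sum.inr) ⬝ᵥ (v ∘ Sum.inr)) ≤ k * (v ⬝ᵥ v) := by
    gcongr
    exact dotProduct_comp_inr_le v
  simp only [dotProduct, Function.comp_apply] at h h1 ⊢
  linarith

/-- Exponential decay of trajectories as long as they satisfy the closed-loop equations in a ball
around the equilibrium. -/
theorem exists_exp_decay {k a : ℝ} (hk0 : 0 < k)
    (hk : ∀ v, k * (v ⬝ᵥ v) ≤ v ⬝ᵥ (-M.shuntedB bsh) *ᵥ v) (ha : 0 < a)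
    (hQ : ‖Q‖ ≤ k * a ^ 2 / 4) {F : Fin n ⊕ Fin m → ℝ}
    (hF : M.IsEquilibrium (zipLoad bsh Ish Q) F) (hFa : ∀ i, 2 * a ≤ F (Sum.inl i)) :
    ∃ ρ > 0, ρ ≤ a ∧ ∃ c ≥ 1, ∃ lam > 0, ∀ σ ≤ ρ, ∀ (T : ℝ) (E : ℝ → Fin n ⊕ Fin m → ℝ),
      ContinuousOn E (Set.Ico 0 T) →
      (∀ t ∈ Set.Ico 0 T, ‖E t - F‖ ≤ σ →
        (∀ i : Fin n, M.closedLoop (zipLoad bsh Ish Q) (E t) (Sum.inl i) = 0) ∧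
        ∀ i : Fin m, HasDerivWithinAt (fun s => E s (Sum.inr i))
          (M.closedLoop (zipLoad bsh Ish Q) (E t) (Sum.inr i) / M.tau i) (Set.Ico 0 T) t) →
      c * ‖E 0 - F‖ < σ →
      ∀ t ∈ Set.Ico 0 T, ‖E t - F‖ ≤ c * Real.exp (-(lam * t)) * ‖E 0 - F‖ := by
  obtain ⟨S, hS0, hS⟩ := (M.shuntedB bsh).exists_norm_mulVec_le
  obtain ⟨g, hg0, hg⟩ := exists_pos_forall_ge fun i : Fin m => hF.1 (Sum.inr i)
  obtain ⟨w, hw0, hw⟩ := exists_pos_forall_ge (f := fun i : Fin m => M.tau i / F (Sum.inr i))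
    fun i => div_pos (M.tau_pos i) (hF.1 _)
  obtain ⟨w', hw'0, hw'⟩ := exists_pos_forall_le fun i : Fin m => M.tau i / F (Sum.inr i)
  obtain ⟨C, hC0, hC⟩ := M.exists_norm_sub_le (Ish := Ish) hk0 hk ha hQ
  -- The function W decays at rate k / w' and is comparable to ‖v_I‖², so the norm decays at half
  -- that rate. The added 1 ensures c ≥ 1.
  refine ⟨min a (k * g / (4 * S)), lt_min ha (by positivity), min_le_left _ _,
    C * √(w' * m / w) + 1, le_add_of_nonneg_left (by positivity), k / w' / 2, by positivity,
    fun σ hσ T E hEc hE h0 => ?_⟩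
  set c := C * √(w' * m / w) + 1 with hc
  have hc1 : 1 ≤ c := le_add_of_nonneg_left (by positivity)
  have hσa : σ ≤ a := hσ.trans (min_le_left _ _)
  have hσS : 4 * (S * σ) ≤ k * g := by
    have := hσ.trans (min_le_right _ _)
    rw [le_div_iff₀ (by positivity)] at this
    linarith
  have hge : ∀ t, ‖E t - F‖ ≤ σ → ∀ i, a ≤ E t (Sum.inl i) := fun t ht i => by
    have h1 := (norm_le_pi_norm (E t - F) (Sum.inl i)).trans ht
    have h2 := neg_abs_le ((E t - F) (Sum.inl i))
    rw [Real.norm_eq_abs] at h1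
    have h3 := hFa i
    simp only [Pi.sub_apply] at h1 h2
    linarith
  have hFa' : ∀ i, a ≤ F (Sum.inl i) := fun i => by linarith [hFa i]
  have hdecay : ∀ s ∈ Set.Ico 0 T, (∀ t ∈ Set.Icc 0 s, ‖E t - F‖ ≤ σ) →
      ‖E s - F‖ ≤ c * Real.exp (-(k / w' / 2 * s)) * ‖E 0 - F‖ := by
    intro s hs hle
    have hmem : ∀ t ∈ Set.Icc 0 s, t ∈ Set.Ico 0 T := fun t ht => ⟨ht.1, ht.2.trans_lt hs.2⟩
    set W : ℝ → ℝ := fun t => ∑ i : Fin m, M.tau i / F (Sum.inr i) *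
      (E t (Sum.inr i) - F (Sum.inr i)) ^ 2 with hW
    have hder : ∀ t ∈ Set.Icc 0 s, HasDerivWithinAt W
        (∑ i, M.tau i / F (Sum.inr i) * (2 * (E t - F) (Sum.inr i) *
          (M.closedLoop (zipLoad bsh Ish Q) (E t) (Sum.inr i) / M.tau i))) (Set.Ico 0 T) t := by
      intro t ht
      refine HasDerivWithinAt.fun_sum fun i _ => HasDerivWithinAt.const_mul _ ?_
      simpa using (((hE t (hmem t ht) (hle t ht)).2 i).sub_const (F (Sum.inr i))).fun_pow 2
    have hWle : ∀ t, W t ≤ w' * (((E t - F) ∘ Sum.inr) ⬝ᵥ ((E t - F) ∘ Sum.inr)) := fun t => by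
      simp only [hW, dotProduct, Finset.mul_sum, Function.comp_apply, Pi.sub_apply, sq]
      exact Finset.sum_le_sum fun i _ => mul_le_mul_of_nonneg_right (hw' i) (mul_self_nonneg _)
    have hleW : ∀ t, w * (((E t - F) ∘ Sum.inr) ⬝ᵥ ((E t - F) ∘ Sum.inr)) ≤ W t := fun t => by
      simp only [hW, dotProduct, Finset.mul_sum, Function.comp_apply, Pi.sub_apply, sq]
      exact Finset.sum_le_sum fun i _ => mul_le_mul_of_nonneg_right (hw i) (mul_self_nonneg _)
    have hgron := le_mul_exp_of_hasDerivWithinAt_le (k := k / w') hs hder fun t ht => by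
      refine (M.sum_lyapunov_deriv_le hk hk0 ha hQ hS0 hS hF hg hσS (hge t (hle t ht)) hFa'
        (hE t (hmem t ht) (hle t ht)).1 (hle t ht)).trans ?_
      have := mul_le_mul_of_nonneg_left (hWle t) (div_pos hk0 hw'0).le
      have e : k / w' * (w' * (((E t - F) ∘ Sum.inr) ⬝ᵥ ((E t - F) ∘ Sum.inr))) =
          k * (((E t - F) ∘ Sum.inr) ⬝ᵥ ((E t - F) ∘ Sum.inr)) := by field_simp
      linarith
    have hsq : ‖(E s - F) ∘ Sum.inr‖ ^ 2 ≤
        (√(w' * m / w) * Real.exp (-(k / w' / 2 * s)) * ‖E 0 - F‖) ^ 2 := by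
      rw [mul_pow, mul_pow, Real.sq_sqrt (by positivity), ← Real.exp_nat_mul,
        show ((2 : ℕ) : ℝ) * -(k / w' / 2 * s) = -(k / w') * s by push_cast; ring]
      have h1 := norm_sq_le_dotProduct_self ((E s - F) ∘ Sum.inr)
      have h2 := dotProduct_self_le_card_mul_norm_sq ((E 0 - F) ∘ Sum.inr)
      rw [Fintype.card_fin] at h2
      have h3 : ‖(E 0 - F) ∘ Sum.inr‖ ^ 2 ≤ ‖E 0 - F‖ ^ 2 := by
        gcongr
        exact Pi.norm_comp_le_norm _ _
      rw [div_mul_eq_mul_div, div_mul_eq_mul_div, le_div_iff₀ hw0]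
      calc ‖(E s - F) ∘ Sum.inr‖ ^ 2 * w
          ≤ w * (((E s - F) ∘ Sum.inr) ⬝ᵥ ((E s - F) ∘ Sum.inr)) := by
            rw [mul_comm]; gcongr
        _ ≤ W 0 * Real.exp (-(k / w') * s) := (hleW s).trans hgron
        _ ≤ (w' * (m * ‖E 0 - F‖ ^ 2)) * Real.exp (-(k / w') * s) := by
          gcongr
          exact (hWle 0).trans (by gcongr; exact h2.trans (by gcongr))
        _ = _ := by ring
    have hη := le_of_sq_le_sq hsq (by positivity)
    calc ‖E s - F‖ ≤ C * ‖(E s - F) ∘ Sum.inr‖ :=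
          hC _ _ (hge s (hle s ⟨hs.1, le_rfl⟩)) hFa' (hE s hs (hle s ⟨hs.1, le_rfl⟩)).1
            fun i => congrFun hF.2 _
      _ ≤ C * (√(w' * m / w) * Real.exp (-(k / w' / 2 * s)) * ‖E 0 - F‖) := by gcongr
      _ = C * √(w' * m / w) * (Real.exp (-(k / w' / 2 * s)) * ‖E 0 - F‖) := by ring
      _ ≤ c * (Real.exp (-(k / w' / 2 * s)) * ‖E 0 - F‖) := by
        gcongr
        exact (lt_add_one _).le
      _ = _ := by ring
  -- The decay estimate holds while the trajectory is within `σ` and itself gives a bound strictly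
  -- below `σ`, so the boundary is never reached.
  have hlt : ∀ s ∈ Set.Ico 0 T, ‖E s - F‖ < σ := by
    refine ContinuousOn.forall_lt_of_forall_le_imp_lt (f := fun s => ‖E s - F‖)
      (hEc.sub continuousOn_const).norm ?_ fun s hs hle => (hdecay s hs hle).trans_lt ?_
    · exact (le_mul_of_one_le_left (norm_nonneg _) hc1).trans_lt h0
    · refine lt_of_le_of_lt ?_ h0
      gcongr
      refine mul_le_of_le_one_right (by positivity) (Real.exp_le_one_iff.2 ?_)
      have := hs.1
      have : 0 ≤ k / w' / 2 * s := by positivity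
      linarith
  exact fun t ht => hdecay t ht fun s hs => (hlt s ⟨hs.1, hs.2.trans_lt ht.2⟩).le

end Microgrid

/-! ### Solvability of the load equations and local exponential stability. -/

namespace Microgrid

open Matrix Metric

variable {n m : ℕ} (M : Microgrid n m) {bsh Ish Q : Fin n → ℝ}

/-- Local solvability of the load equations for the load voltages. -/
theorem exists_closedLoop_inl_eq_zero {p a ρ : ℝ} (hdet : IsUnit (-(M.BLL + diagonal bsh)).det)
    (hp0 : 0 ≤ p) (hp : ∀ v, ‖(-(M.BLL + diagonal bsh))⁻¹ *ᵥ v‖ ≤ p * ‖v‖) (ha : 0 < a)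
    (hQ : p * ‖Q‖ ≤ a ^ 2 / 2) {F : Fin n ⊕ Fin m → ℝ}
    (hF : ∀ i, M.closedLoop (zipLoad bsh Ish Q) F (Sum.inl i) = 0) (hρ : 0 < ρ)
    (hFa : ∀ i, a + ρ ≤ F (Sum.inl i)) :
    ∃ σ > 0, ∀ y : Fin m → ℝ, ‖y - F ∘ Sum.inr‖ ≤ σ → ∃ x : Fin n → ℝ,
      ‖x - F ∘ Sum.inl‖ ≤ ρ ∧
        ∀ i, M.closedLoop (zipLoad bsh Ish Q) (Sum.elim x y) (Sum.inl i) = 0 := by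
  set A := -(M.BLL + diagonal bsh) with hA
  have hiff : ∀ (x : Fin n → ℝ) (y : Fin m → ℝ), (∀ i, 0 < x i) →
      ((∀ i, M.closedLoop (zipLoad bsh Ish Q) (Sum.elim x y) (Sum.inl i) = 0) ↔
        x = A⁻¹ *ᵥ (Ish + M.BLI *ᵥ y) + A⁻¹ *ᵥ (Q / x)) := fun x y hx => by
    have h1 : (∀ i, M.closedLoop (zipLoad bsh Ish Q) (Sum.elim x y) (Sum.inl i) = 0) ↔
        A *ᵥ x = Ish + M.BLI *ᵥ y + Q / x := by
      rw [funext_iff]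
      refine forall_congr' fun i => ?_
      rw [M.closedLoop_zipLoad_inl_eq_zero_iff (hx i), shuntedB_mulVec_inl, B_mulVec_inl, hA,
        neg_mulVec, add_mulVec]
      simp only [Sum.elim_inl, Pi.add_apply, Pi.neg_apply, Pi.div_apply, mulVec_diagonal]
      constructor <;> intro h <;> linarith
    rw [h1, ← mulVec_add]
    constructor <;> intro h
    · rw [← h, mulVec_mulVec, nonsing_inv_mul _ hdet, one_mulVec]
    · conv_lhs => rw [h]
      rw [mulVec_mulVec, mul_nonsing_inv _ hdet, one_mulVec]
  have hFpos : ∀ i, 0 < (F ∘ Sum.inl) i := fun i => by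
    have := hFa i
    simp only [Function.comp_apply]
    linarith
  obtain ⟨q, hq0, hq⟩ := (A⁻¹ * M.BLI).exists_norm_mulVec_le
  -- At `F ∘ Sum.inl` the fixed point map is off by A⁻¹ B_LI (y - F_I), which this radius bounds by
  -- ρ / 2.
  refine ⟨ρ / (2 * q), by positivity, fun y hy => ?_⟩
  obtain ⟨x, hx, hxe⟩ := exists_eq_add_mulVec_div (u := A⁻¹ *ᵥ (Ish + M.BLI *ᵥ y))
    (x₀ := F ∘ Sum.inl) hp0 hp ha hρ.le hFa hQ (by
      have h := (hiff (F ∘ Sum.inl) (F ∘ Sum.inr) hFpos).1 (by rwa [Sum.elim_comp_inl_inr])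
      have e : A⁻¹ *ᵥ (Ish + M.BLI *ᵥ y) + A⁻¹ *ᵥ (Q / (F ∘ Sum.inl)) - F ∘ Sum.inl =
          (A⁻¹ * M.BLI) *ᵥ (y - F ∘ Sum.inr) := by
        conv_lhs => rw [sub_eq_add_neg]; arg 2; rw [h]
        rw [← mulVec_mulVec, mulVec_sub, mulVec_sub, mulVec_add, mulVec_add]
        abel
      rw [e]
      refine (hq _).trans ?_
      rw [le_div_iff₀ (by positivity)] at hy
      linarith)
  rw [mem_closedBall_iff_norm] at hx
  refine ⟨x, hx, (hiff x y fun i => ?_).2 hxe⟩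
  have h1 := (norm_le_pi_norm (x - F ∘ Sum.inl) i).trans hx
  have h2 := neg_abs_le ((x - F ∘ Sum.inl) i)
  rw [Real.norm_eq_abs] at h1
  have h3 := hFa i
  simp only [Pi.sub_apply, Function.comp_apply] at h1 h2
  linarith

theorem contDiff_closedLoop_inr_div_tau (Q : Fin n → ℝ → ℝ) :
    ContDiff ℝ 1 fun (E : Fin n ⊕ Fin m → ℝ) (i : Fin m) =>
      M.closedLoop Q E (Sum.inr i) / M.tau i := by
  simp only [closedLoop_inr, mulVec, dotProduct]
  fun_prop

/-- Global solvability of an extension of the closed-loop system by which the load voltages are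
given by a Lipschitz function of the inverter voltages. -/
theorem exists_global_solution (L : Fin n → ℝ → ℝ) {F : Fin n ⊕ Fin m → ℝ} {ρ : ℝ}
    {φ : (Fin m → ℝ) → Fin n ⊕ Fin m → ℝ} {C : NNReal} (hφ : LipschitzWith C φ)
    (hφF : ∀ y, φ y ∈ closedBall F ρ) (y₀ : Fin m → ℝ) :
    ∃ y : ℝ → Fin m → ℝ, y 0 = y₀ ∧ ∀ t ∈ Set.Ici 0, ∀ i, HasDerivWithinAt (fun s => y s i)
      (M.closedLoop L (φ (y t)) (Sum.inr i) / M.tau i) (Set.Ici 0) t := by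
  have hG := M.contDiff_closedLoop_inr_div_tau L
  have hK : IsCompact (closedBall F ρ) := isCompact_closedBall _ _
  obtain ⟨K, hlip⟩ := hG.contDiffOn.exists_lipschitzOnWith one_ne_zero (convex_closedBall F ρ) hK
  obtain ⟨B, hB⟩ := hK.exists_bound_of_continuousOn hG.continuous.continuousOn
  have hlip' := (hlip.comp hφ.lipschitzOnWith fun y (_ : y ∈ Set.univ) => hφF y)
  rw [lipschitzOnWith_univ] at hlip'
  obtain ⟨y, hy0, hy⟩ := exists_hasDerivWithinAt_Ici_of_lipschitzWith hlip' (L := B.toNNReal)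
    (fun y => (hB _ (hφF y)).trans (Real.le_coe_toNNReal B)) y₀
  exact ⟨y, hy0, fun t ht => hasDerivWithinAt_pi.1 (hy t ht)⟩

/-- Equilibria with large enough load voltages are locally exponentially stable if the reactive
power loads are small. -/
theorem IsEquilibrium.isLocallyExpStable {M : Microgrid n m} {k a p : ℝ} (hk0 : 0 < k)
    (hk : ∀ v, k * (v ⬝ᵥ v) ≤ v ⬝ᵥ (-M.shuntedB bsh) *ᵥ v) (ha : 0 < a)
    (hQ : ‖Q‖ ≤ k * a ^ 2 / 4) (hdet : IsUnit (-(M.BLL + diagonal bsh)).det)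
    (hp0 : 0 ≤ p) (hp : ∀ v, ‖(-(M.BLL + diagonal bsh))⁻¹ *ᵥ v‖ ≤ p * ‖v‖)
    (hpQ : p * ‖Q‖ ≤ a ^ 2 / 2) {F : Fin n ⊕ Fin m → ℝ}
    (hF : M.IsEquilibrium (zipLoad bsh Ish Q) F) (hFa : ∀ i, 2 * a ≤ F (Sum.inl i)) :
    M.IsLocallyExpStable (zipLoad bsh Ish Q) F := by
  have hF0 : ∀ i, M.closedLoop (zipLoad bsh Ish Q) F (Sum.inl i) = 0 := fun i => congrFun hF.2 _
  obtain ⟨ρ, hρ0, hρa, c, hc, lam, hlam, hdecay⟩ := M.exists_exp_decay hk0 hk ha hQ hF hFa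
  obtain ⟨C, hC0, hC⟩ := M.exists_norm_sub_le (Ish := Ish) hk0 hk ha hQ
  obtain ⟨σ₀, hσ₀, hsolve⟩ := M.exists_closedLoop_inl_eq_zero hdet hp0 hp ha hpQ hF0 hρ0
    fun i => by linarith [hFa i]
  set σ := min σ₀ ρ with hσ
  have hσ0 : 0 < σ := lt_min hσ₀ hρ0
  have hσρ : σ ≤ ρ := min_le_right _ _
  have hc0 : 0 < c := by linarith
  have hge : ∀ E : Fin n ⊕ Fin m → ℝ, ‖E - F‖ ≤ ρ → ∀ i, a ≤ E (Sum.inl i) := fun E hE i => by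
    have h1 := (norm_le_pi_norm (E - F) (Sum.inl i)).trans hE
    have h2 := neg_abs_le ((E - F) (Sum.inl i))
    rw [Real.norm_eq_abs] at h1
    have h3 := hFa i
    simp only [Pi.sub_apply] at h1 h2
    linarith
  refine ⟨hF, σ / c, by positivity, c, hc0, lam, hlam, fun E₀ hE₀ hE₀Q => ?_,
    fun T E hE hE0 t ht => ?_⟩
  · rw [lt_div_iff₀ hc0, mul_comm] at hE₀
    have hE₀σ : ‖E₀ - F‖ ≤ σ := (le_mul_of_one_le_left (norm_nonneg _) hc).trans hE₀.le
    -- The clamp extends the locally solved loads to all inverter voltages. The solutions `h` are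
    -- merely chosen; their Lipschitz dependence comes from `exists_norm_sub_le`.
    set π : (Fin m → ℝ) → Fin m → ℝ := Pi.clamp (F ∘ Sum.inr) σ with hπ
    choose h hhF hhQ using fun y => hsolve (π y)
      ((Pi.norm_clamp_sub_le (F ∘ Sum.inr) hσ0.le y).trans (min_le_left _ _))
    set φ : (Fin m → ℝ) → Fin n ⊕ Fin m → ℝ := fun y => Sum.elim (h y) (π y) with hφ
    have hφF : ∀ y, ‖φ y - F‖ ≤ ρ := fun y =>
      Pi.norm_sumElim_sub_le (hhF y) ((Pi.norm_clamp_sub_le _ hσ0.le y).trans hσρ)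
    have hφlip : LipschitzWith C.toNNReal φ := LipschitzWith.of_dist_le_mul fun y z => by
      rw [dist_eq_norm, dist_eq_norm, Real.coe_toNNReal _ hC0.le]
      refine (hC _ _ (hge _ (hφF y)) (hge _ (hφF z)) (hhQ y) (hhQ z)).trans ?_
      gcongr
      exact Pi.norm_clamp_sub_clamp_le _ _ y z
    obtain ⟨y, hy0, hy⟩ := M.exists_global_solution (zipLoad bsh Ish Q) hφlip
      (fun y => mem_closedBall_iff_norm.2 (hφF y)) (E₀ ∘ Sum.inr)
    have hyc : ContinuousOn y (Set.Ici 0) := continuousOn_pi.2 fun i t ht =>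
      (hy t ht i).continuousWithinAt
    have hφy : ∀ y, ‖y - F ∘ Sum.inr‖ ≤ σ → φ y = Sum.elim (h y) y := fun y hy => by
      rw [hφ, hπ]
      simp only [Pi.clamp_eq_self hy]
    -- The inverter part is the unclamped `y`, so ‖E t - F‖ ≤ σ certifies that the clamp is inactive
    -- at time `t`.
    set E : ℝ → Fin n ⊕ Fin m → ℝ := fun t => Sum.elim (h (y t)) (y t) with hEdef
    have hEc : ContinuousOn E (Set.Ici 0) := continuousOn_pi.2 fun i => by
      rcases i with i | i
      · exact (continuous_apply (Sum.inl i)).comp_continuousOn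
          (hφlip.continuous.comp_continuousOn hyc)
      · exact (continuous_apply i).comp_continuousOn hyc
    have hEφ : ∀ t, ‖E t - F‖ ≤ σ → φ (y t) = E t := fun t ht =>
      hφy _ ((Pi.norm_comp_le_norm (E t - F) Sum.inr).trans ht)
    have hEtraj : ∀ t ∈ Set.Ici (0 : ℝ), ‖E t - F‖ ≤ σ →
        (∀ i : Fin n, M.closedLoop (zipLoad bsh Ish Q) (E t) (Sum.inl i) = 0) ∧
        ∀ i : Fin m, HasDerivWithinAt (fun s => E s (Sum.inr i))
          (M.closedLoop (zipLoad bsh Ish Q) (E t) (Sum.inr i) / M.tau i) (Set.Ici 0) t :=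
      fun t ht hle => by
        rw [← hEφ t hle]
        exact ⟨hhQ (y t), hy t ht⟩
    have hE0 : E 0 = E₀ := by
      have h1 : φ (E₀ ∘ Sum.inr) = Sum.elim (h (E₀ ∘ Sum.inr)) (E₀ ∘ Sum.inr) :=
        hφy _ ((Pi.norm_comp_le_norm (E₀ - F) Sum.inr).trans hE₀σ)
      -- States near `F` with equal inverter voltages coincide, so the chosen loads reproduce those
      -- of `E₀`.
      have h2 := hC _ E₀ (hge _ (hφF (E₀ ∘ Sum.inr))) (hge E₀ (hE₀σ.trans hσρ))
        (hhQ (E₀ ∘ Sum.inr)) hE₀Q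
      have h3 : (φ (E₀ ∘ Sum.inr) - E₀) ∘ Sum.inr = 0 := by
        rw [h1]
        funext i
        simp
      rw [h3, norm_zero, mul_zero, norm_le_zero_iff, sub_eq_zero] at h2
      rw [hEdef]
      simp only [hy0]
      rw [← h1, h2]
    have hstay : ∀ t ∈ Set.Ici (0 : ℝ), ‖E t - F‖ ≤ σ := fun t ht => by
      have hsub : Set.Ico 0 (t + 1) ⊆ Set.Ici (0 : ℝ) := Set.Ico_subset_Ici_self
      have := hdecay σ hσρ (t + 1) E (hEc.mono hsub)
        (fun s hs hle => ⟨(hEtraj s (hsub hs) hle).1,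
          fun i => ((hEtraj s (hsub hs) hle).2 i).mono hsub⟩) (by rwa [hE0]) t ⟨ht, by linarith⟩
      refine this.trans (le_trans ?_ hE₀.le)
      rw [hE0]
      gcongr
      refine mul_le_of_le_one_right hc0.le (Real.exp_le_one_iff.2 ?_)
      have : 0 ≤ lam * t := mul_nonneg hlam.le ht
      linarith
    exact ⟨E, ⟨hEc, fun t ht => hEtraj t ht (hstay t ht)⟩, hE0⟩
  · rw [lt_div_iff₀ hc0, mul_comm] at hE0
    exact hdecay σ hσρ T E hE.1 (fun t ht _ => hE.2 t ht) hE0 t ht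

end Microgrid

/-! ### Assembly of the main theorem. -/

theorem theorem4 {n m : ℕ} (hn : 1 ≤ n) (hm : 1 ≤ m) (M : Microgrid n m)
    (bsh Ish : Fin n → ℝ)
    (hM : IsMMatrix (-(M.Bred + Matrix.diagonal bsh)))
    (hI : ∀ i, (M.Bred *ᵥ M.Eopen) i < Ish i) :
    M.IsPositiveReducedSolution (zipLoad bsh Ish 0) (M.EZI bsh Ish) ∧
    IsUnit (M.Qsc bsh Ish).det ∧
    ∃ δ > 0, ∃ r > 0, ∃ C : ℝ, ∀ QL : Fin n → ℝ, ‖QL‖ < δ →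
      ∃ EL : Fin n → ℝ,
        -- the unique high-voltage solution
        M.IsHighVoltageSolution (zipLoad bsh Ish QL) EL ∧
        (∀ x, M.IsHighVoltageSolution (zipLoad bsh Ish QL) x → x = EL) ∧
        -- it is also the only positive solution in a fixed neighbourhood of the ZI solution
        ‖EL - M.EZI bsh Ish‖ < r ∧
        (∀ x, M.IsPositiveReducedSolution (zipLoad bsh Ish QL) x →
          ‖x - M.EZI bsh Ish‖ < r → x = EL) ∧
        -- its expansion, with a quadratically small error
        (∃ ε : Fin n → ℝ,
          EL = Matrix.diagonal (M.EZI bsh Ish) *ᵥ (1 - (M.Qsc bsh Ish)⁻¹ *ᵥ QL + ε) ∧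
          ‖ε‖ ≤ C * ‖(M.Qsc bsh Ish)⁻¹ *ᵥ QL‖ ^ 2) ∧
        -- stability of the corresponding equilibrium
        M.IsLocallyExpStable (zipLoad bsh Ish QL) (Sum.elim EL (M.inverterVoltages EL)) := by
  set A := -(M.Bred + Matrix.diagonal bsh) with hAdef
  have hA : A.PosDef := (M.neg_Bred_add_diagonal_isHermitian hm bsh).posDef_of_spectrum_re_pos hM.2
  have hAdet : IsUnit A.det := hA.det_pos.ne'.isUnit
  set e := M.EZI bsh Ish with hedef
  have hBA : M.Bred + Matrix.diagonal bsh = -A := (neg_neg _).symm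
  have hBdet : IsUnit (M.Bred + Matrix.diagonal bsh).det := by
    rw [← Matrix.isUnit_iff_isUnit_det, hBA]
    exact hA.isUnit.neg
  have hAe : A *ᵥ e = Ish - M.Bred *ᵥ M.Eopen := by
    rw [hAdef, Matrix.neg_mulVec, hedef, Microgrid.EZI, Matrix.mulVec_mulVec,
      Matrix.mul_nonsing_inv _ hBdet, Matrix.one_mulVec, neg_sub]
  have hAe' : ∀ i, (A *ᵥ e) i = Ish i - (M.Bred *ᵥ M.Eopen) i := fun i => congrFun hAe i
  have hc : ∀ i, 0 < (A *ᵥ e) i := fun i => by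
    rw [hAe']
    exact sub_pos.2 (hI i)
  have he : ∀ i, 0 < e i := hA.pos_of_mulVec_pos hM.1 hc
  have hsol : ∀ QL x : Fin n → ℝ, M.IsPositiveReducedSolution (zipLoad bsh Ish QL) x ↔
      (∀ i, 0 < x i) ∧ ∀ i, x i * ((A *ᵥ x) i - (A *ᵥ e) i) = QL i := fun QL x => by
    rw [M.isPositiveReducedSolution_zipLoad_iff, ← hAdef]
    simp only [hAe']
  have hD : IsUnit (Matrix.diagonal e).det := by
    rw [Matrix.det_diagonal]
    exact (Finset.prod_pos fun i _ => he i).ne'.isUnit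
  have hQsc : M.Qsc bsh Ish = Matrix.diagonal e * (M.Bred + Matrix.diagonal bsh) *
      Matrix.diagonal e := rfl
  have hQdet : IsUnit (M.Qsc bsh Ish).det := by
    rw [hQsc, Matrix.det_mul, Matrix.det_mul]
    exact (hD.mul hBdet).mul hD
  refine ⟨(hsol 0 e).2 ⟨he, fun i => by simp⟩, hQdet, ?_⟩
  obtain ⟨g, hg0, hg⟩ := exists_pos_forall_ge he
  -- A third of the lower bound of `e`: within distance `r` of `e` the components stay above 2 r, as
  -- the stability lemma with a = r requires.
  set r := g / 3 with hr
  have hr0 : 0 < r := by positivity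
  have her : ∀ i, 3 * r ≤ e i := fun i => by linarith [hg i]
  obtain ⟨δ, hδ0, C, hC0, hflow⟩ := exists_greatest_mul_mulVec_sub_eq hAdet hM.1 hc hr0 her
  have hH := M.neg_shuntedB_posDef hm hA
  obtain ⟨k, hk0, hk⟩ := hH.exists_mul_dotProduct_le
  have hLL : (-(M.BLL + Matrix.diagonal bsh)).PosDef := by
    have h := hH.submatrix (e := Sum.inl) Sum.inl_injective
    rw [M.neg_shuntedB_eq_fromBlocks] at h
    exact h
  obtain ⟨p, hp0, hp⟩ := (-(M.BLL + Matrix.diagonal bsh))⁻¹.exists_norm_mulVec_le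
  obtain ⟨q, hq0, hq⟩ := (M.Qsc bsh Ish).exists_norm_mulVec_le
  -- The three bounds serve the power flow perturbation, the dissipation inequality and the
  -- solvability of the load equations.
  refine ⟨min δ (min (k * r ^ 2 / 4) (r ^ 2 / (2 * p))), by positivity, r, hr0,
    C * q ^ 2 / g, fun QL hQL => ?_⟩
  obtain ⟨hQδ, hQL'⟩ := lt_min_iff.1 hQL
  obtain ⟨hQk, hQp⟩ := lt_min_iff.1 hQL'
  obtain ⟨x, hx, hxQ, hxr, hxy, hxε⟩ := hflow QL hQδ
  have hxsol : M.IsPositiveReducedSolution (zipLoad bsh Ish QL) x := (hsol QL x).2 ⟨hx, hxQ⟩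
  have hgreat : M.IsHighVoltageSolution (zipLoad bsh Ish QL) x :=
    ⟨hxsol, fun y hy => (hxy y hy.1 ((hsol QL y).1 hy).2).1⟩
  refine ⟨x, hgreat, fun y hy => hy.unique hgreat, hxr,
    fun y hy => (hxy y hy.1 ((hsol QL y).1 hy).2).2,
    ⟨(x - e - A⁻¹ *ᵥ (QL / e)) / e, ?_, ?_⟩, ?_⟩
  -- Since Q_sc = -[e] A [e], the linear term of the expansion is that of the fixed point equation
  -- divided by `e`.
  · have h : (M.Qsc bsh Ish)⁻¹ *ᵥ QL = -((A⁻¹ *ᵥ (QL / e)) / e) := by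
      have h1 : M.Qsc bsh Ish *ᵥ (-((A⁻¹ *ᵥ (QL / e)) / e)) = QL := by
        have h2 : Matrix.diagonal e *ᵥ ((A⁻¹ *ᵥ (QL / e)) / e) = A⁻¹ *ᵥ (QL / e) := by
          funext i
          rw [Matrix.mulVec_diagonal, Pi.div_apply, mul_div_cancel₀ _ (he i).ne']
        rw [hQsc, hBA, Matrix.mul_neg, Matrix.neg_mul, Matrix.neg_mulVec, Matrix.mulVec_neg,
          neg_neg, ← Matrix.mulVec_mulVec, ← Matrix.mulVec_mulVec, h2, Matrix.mulVec_mulVec _ A,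
          Matrix.mul_nonsing_inv _ hAdet, Matrix.one_mulVec]
        funext i
        rw [Matrix.mulVec_diagonal, Pi.div_apply, mul_div_cancel₀ _ (he i).ne']
      conv_lhs => rw [← h1]
      rw [Matrix.mulVec_mulVec, Matrix.nonsing_inv_mul _ hQdet, Matrix.one_mulVec]
    rw [h]
    funext i
    have := (he i).ne'
    simp only [Matrix.mulVec_diagonal, Pi.add_apply, Pi.sub_apply, Pi.neg_apply, Pi.div_apply,
      Pi.one_apply]
    field_simp
    ring
  · have h1 : ‖QL‖ ≤ q * ‖(M.Qsc bsh Ish)⁻¹ *ᵥ QL‖ := by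
      have := hq ((M.Qsc bsh Ish)⁻¹ *ᵥ QL)
      rwa [Matrix.mulVec_mulVec, Matrix.mul_nonsing_inv _ hQdet, Matrix.one_mulVec] at this
    calc ‖(x - e - A⁻¹ *ᵥ (QL / e)) / e‖ ≤ ‖x - e - A⁻¹ *ᵥ (QL / e)‖ / g :=
          Pi.norm_div_le_of_le hg0 hg
      _ ≤ C * (q * ‖(M.Qsc bsh Ish)⁻¹ *ᵥ QL‖) ^ 2 / g := by
        gcongr
        exact hxε.trans (by gcongr)
      _ = _ := by ring
  · refine (hxsol.isEquilibrium hm).isLocallyExpStable hk0 hk hr0 hQk.le hLL.det_pos.ne'.isUnit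
      hp0.le hp ?_ fun i => ?_
    · rw [lt_div_iff₀ (by positivity)] at hQp
      linarith
    · have h1 := (norm_le_pi_norm (x - e) i).trans hxr.le
      have h2 := neg_abs_le ((x - e) i)
      rw [Real.norm_eq_abs] at h1
      have h3 := her i
      simp only [Pi.sub_apply] at h1 h2
      rw [Sum.elim_inl]
      linarith
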